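/- Let $\mathcal R'$ be a Riemann surface without boundary and let $\mathcal M\subseteq\mathcal R'$ be a closed subset, regarded as a Riemann surface with boundary: $\partial\mathcal M\neq\emptyset$ is a closed subset of $\mathcal M$ that consists of the topological frontier of $\mathcal M$ in $\mathcal R'$ and possibly of further points that are isolated in $\partial\mathcal M$, and $\mathrm{Int}(\mathcal M)=\mathcal M\setminus\partial\mathcal M$. Let $Y=(Y_1,Y_2,Y_3):\mathcal M\to\mathbb R^3$ be the restriction of a smooth map $\mathcal R'\to\mathbb R^3$ such that $Y$ is a conformal immersion with zero mean curvature on $\mathrm{Int}(\mathcal M)$ (a conformal minimal immersion, possibly singular at boundary points), and suppose that $Y:\mathcal M\to\mathbb R^3$ is proper. Let $\pi_0:\mathbb R^3\to\{x_3=0\}\equiv\mathbb C$ be the orthogonal projection. Suppose that $Y$ is injective on $\mathcal M$ and that $Y(\mathcal M)$ is a graph over a closed set $\Omega\subseteq\mathbb C$, that is, $Y(\mathcal M)=\{(z,u(z)) : z\in\Omega\}$ for a continuous function $u:\Omega\to\mathbb R$, and that $\Omega$ is starlike with respect to $\pi_0(Y(p_0))$ for some $p_0\in\mathrm{Int}(\mathcal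 M)$, that is, $\Omega$ contains the segment from $\pi_0(Y(p_0))$ to each of its points. Then $\mathcal M$ is relative parabolic: if $f:\mathcal M\to\mathbb R$ is bounded and continuous on $\mathcal M$, harmonic in $\mathrm{Int}(\mathcal M)$, and zero on $\partial\mathcal M$, then $f=0$ on $\mathcal M$. -/

import Mathlib

open scoped Manifold ContDiff Topology

noncomputable section

namespace MinimalGraph

/-- Euclidean three-space. -/
abbrev E3 : Type := EuclideanSpace ℝ (Fin 3)

/-- The orthogonal projection onto the plane `{x₃ = 0}`, identified with `ℂ`. -/
def proj (x : E3) : ℂ := ⟨x 0, x 1⟩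

/-- The partial derivative `∂F/∂u`, where `z = u + i v`. -/
def du (F : ℂ → E3) (z : ℂ) : E3 := fderiv ℝ F z 1

/-- The partial derivative `∂F/∂v`, where `z = u + i v`. -/
def dv (F : ℂ → E3) (z : ℂ) : E3 := fderiv ℝ F z Complex.I

/-- The cross product in Euclidean three-space. -/
def cross (a b : E3) : E3 := WithLp.toLp 2 (crossProduct (WithLp.ofLp a) (WithLp.ofLp b))

/-- The unit normal of a parametrized surface `F`. -/
def unitNormal (F : ℂ → E3) (z : ℂ) : E3 :=
  ‖cross (du F z) (dv F z)‖⁻¹ • cross (du F z) (dv F z)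

/-- The mean curvature `(eG - 2fF + gE) / (2(EG - F²))` of a parametrized surface in terms of
its first and second fundamental forms. -/
def meanCurvature (F : ℂ → E3) (z : ℂ) : ℝ :=
  (inner ℝ (du (du F) z) (unitNormal F z) * inner ℝ (dv F z) (dv F z)
      - 2 * inner ℝ (du (dv F) z) (unitNormal F z) * inner ℝ (du F z) (dv F z)
      + inner ℝ (dv (dv F) z) (unitNormal F z) * inner ℝ (du F z) (du F z)) /
    (2 * (inner ℝ (du F z) (du F z) * inner ℝ (dv F z) (dv F z)
      - inner ℝ (du F z) (dv F z) ^ 2))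

section Surface

variable {R : Type*} [TopologicalSpace R] [ChartedSpace ℂ R]

/-- `M` is a closed subset of the surface `R`, regarded as a surface with boundary `B`: the
boundary consists of the topological frontier of `M` and possibly of further isolated points.
The interior of the surface with boundary is `M \ B`, which is open in `R`. -/
structure IsSurfaceWithBoundary (M B : Set R) : Prop where
  isClosed : IsClosed M
  isClosed_boundary : IsClosed B
  boundary_subset : B ⊆ M
  frontier_subset : frontier M ⊆ B
  isolated : ∀ p ∈ B \ frontier M, ∃ U ∈ 𝓝 p, U ∩ B = {p}

/-- A real function on a Riemann surface is harmonic at `p`: in every holomorphic chart of the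
atlas around `p` it is harmonic near the image of `p`. -/
def IsHarmonicAt (f : R → ℝ) (p : R) : Prop :=
  ∀ e ∈ atlas ℂ R, p ∈ e.source → InnerProductSpace.HarmonicAt (f ∘ e.symm) (e p)

/-- The surface `M` with boundary `B` is relative parabolic: a bounded continuous function on `M`
that is harmonic in the interior and vanishes on the boundary is zero. -/
def IsRelativeParabolic (M B : Set R) : Prop :=
  ∀ f : R → ℝ, ContinuousOn f M → (∃ C : ℝ, ∀ p ∈ M, |f p| ≤ C) →
    (∀ p ∈ M \ B, IsHarmonicAt f p) → (∀ p ∈ B, f p = 0) → ∀ p ∈ M, f p = 0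

/-- `Y` is a conformal minimal immersion of the surface `M` with boundary `B`: it is smooth (as a
map on the ambient surface), and in the interior of `M` it is a conformal immersion with zero mean
curvature. It may be singular at boundary points. -/
structure IsConformalMinimalImmersion (Y : R → E3) (M B : Set R) : Prop where
  smooth : ContMDiff 𝓘(ℝ, ℂ) 𝓘(ℝ, E3) ∞ Y
  conformal : ∀ p ∈ M \ B, ∀ e ∈ atlas ℂ R, p ∈ e.source → ConformalAt (Y ∘ e.symm) (e p)
  minimal : ∀ p ∈ M \ B, ∀ e ∈ atlas ℂ R, p ∈ e.source → meanCurvature (Y ∘ e.symm) (e p) = 0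

/-- `Y` maps `M` injectively onto the graph of a continuous function over `Ω`. -/
def IsGraphOver (Y : R → E3) (M : Set R) (Ω : Set ℂ) : Prop :=
  Set.InjOn Y M ∧ ∃ u : ℂ → ℝ, ContinuousOn u Ω ∧
    Y '' M = {x : E3 | proj x ∈ Ω ∧ x 2 = u (proj x)}

end Surface

end MinimalGraph

end

/-!
Write `t = x₂ - t₀`, where `x₂ = t₀` is the vertical plane through the base point.

The coordinates of `Y` are harmonic and `proj ∘ Y` is injective, so by Lewy's theorem `proj ∘ Y` is
a local diffeomorphism on the interior: at a critical point of a linear function of it the level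
set would contain three arcs with a common endpoint, and such a tripod does not embed in a line.

Along a minimal surface `log r - t²` is superharmonic where `r ≥ 1`, `r` being the distance to
a line `{x₁ = 0, x₃ = h}`. A graph over a closed set stays at distance at least `1` from such a line
over a slab `|t| ≤ c`, and properness makes `log r - t²` tend to infinity there. Letting the slab
grow, a subharmonic function that is bounded above and nonpositive on the boundary and on the plane
section `t = 0` is nonpositive.

It remains to control the plane section. The interior of the starlike domain carries a global
holomorphic coordinate whose imaginary part is `t`; its real part is strictly monotone along the
section, whose image is thus an open interval `I ∋ 0` of the real axis. Green functions of the plane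
slit along a segment around `0` in `I`, with poles at the two endpoints of `I`, add up to a positive
harmonic function that tends to infinity at both ends of the section and vanishes on a compact
piece `S` of it. Subtracting small multiples of it from `f` shows that `f` is bounded by its maximum
over `S` or by `0`. By the strong maximum principle a positive maximum would make `f` constant,
which is impossible since `f ≤ 0` on the nonempty boundary.
-/

noncomputable section

open scoped Laplacian
open Set Filter InnerProductSpace

namespace MinimalGraph

section LocalMaximum

theorem deriv_deriv_nonpos_of_isLocalMax {f : ℝ → ℝ} {x : ℝ} (hf : ContinuousAt f x)
    (h : IsLocalMax f x) : deriv (deriv f) x ≤ 0 := by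
  by_contra! hpos
  have hmin := isLocalMin_of_deriv_deriv_pos hpos h.deriv_eq_zero hf
  have hconst : f =ᶠ[𝓝 x] fun _ => f x := by
    filter_upwards [h, hmin] with y hle hge using le_antisymm hle hge
  have hderiv : deriv f =ᶠ[𝓝 x] fun _ => 0 := by simpa only [deriv_const'] using hconst.deriv
  rw [hderiv.deriv_eq, deriv_const] at hpos
  exact hpos.false

variable {E F : Type*} [NormedAddCommGroup E] [NormedAddCommGroup F] [NormedSpace ℝ F]

theorem hasDerivAt_add_smul (x v : F) (s : ℝ) : HasDerivAt (fun s : ℝ => x + s • v) v s := by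
  simpa only [one_smul] using ((hasDerivAt_id' s).smul_const v).const_add x

theorem tendsto_add_smul_nhds_zero (x v : F) : Tendsto (fun s : ℝ => x + s • v) (𝓝 0) (𝓝 x) := by
  simpa only [zero_smul, add_zero] using (hasDerivAt_add_smul x v 0).continuousAt.tendsto

theorem iteratedFDeriv_two_apply_self {G : Type*} [NormedAddCommGroup G] [NormedSpace ℝ G]
    {f : F → G} {x : F} (hf : ContDiffAt ℝ 2 f x) (v : F) :
    iteratedFDeriv ℝ 2 f x ![v, v] = deriv (deriv fun s : ℝ => f (x + s • v)) 0 := by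
  have hdiff : ∀ᶠ y in 𝓝 x, DifferentiableAt ℝ f y :=
    (hf.eventually (by simp)).mono fun y hy => hy.differentiableAt two_ne_zero
  have hderiv : (deriv fun s : ℝ => f (x + s • v)) =ᶠ[𝓝 0] fun s => fderiv ℝ f (x + s • v) v := by
    filter_upwards [(tendsto_add_smul_nhds_zero x v).eventually hdiff] with s hs
    exact (hs.hasFDerivAt.comp_hasDerivAt s (hasDerivAt_add_smul x v s)).deriv
  have hfderiv : DifferentiableAt ℝ (fderiv ℝ f) (x + (0 : ℝ) • v) := by
    rw [zero_smul, add_zero]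
    exact (hf.fderiv_right (m := 1) le_rfl).differentiableAt one_ne_zero
  have hsecond := ((ContinuousLinearMap.apply ℝ G v).hasFDerivAt.comp _
    hfderiv.hasFDerivAt).comp_hasDerivAt (0 : ℝ) (hasDerivAt_add_smul x v 0)
  rw [hderiv.deriv_eq, iteratedFDeriv_two_apply]
  simpa [Function.comp_def] using hsecond.deriv.symm

theorem laplacian_nonpos_of_isLocalMax [InnerProductSpace ℝ E] [FiniteDimensional ℝ E] {f : E → ℝ}
    {x : E} (hf : ContDiffAt ℝ 2 f x) (h : IsLocalMax f x) : Δ f x ≤ 0 := by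
  rw [laplacian_eq_iteratedFDeriv_stdOrthonormalBasis]
  refine Finset.sum_nonpos fun i _ => ?_
  rw [iteratedFDeriv_two_apply_self hf]
  have hline := tendsto_add_smul_nhds_zero x (stdOrthonormalBasis ℝ E i)
  apply deriv_deriv_nonpos_of_isLocalMax
  · simpa [ContinuousAt, Function.comp_def] using hf.continuousAt.tendsto.comp hline
  · simpa [IsLocalMax, IsMaxFilter] using hline.eventually h

theorem exists_analyticAt_re_eventuallyEq {f : ℂ → ℝ} {x : ℂ} (hf : HarmonicAt f x) :
    ∃ F : ℂ → ℂ, AnalyticAt ℂ F x ∧ (fun ζ => (F ζ).re) =ᶠ[𝓝 x] f := by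
  obtain ⟨r, hr, hball⟩ := Metric.eventually_nhds_iff_ball.1 hf.eventually
  obtain ⟨F, hF, hre⟩ := HarmonicOnNhd.exists_analyticOnNhd_ball_re_eq hball
  exact ⟨F, hF x (Metric.mem_ball_self hr), eventuallyEq_of_mem (Metric.ball_mem_nhds x hr) hre⟩

theorem eventually_eq_of_harmonicAt_of_isLocalMax {f : ℂ → ℝ} {x : ℂ} (hf : HarmonicAt f x)
    (h : IsLocalMax f x) : ∀ᶠ y in 𝓝 x, f y = f x := by
  obtain ⟨F, hF, hre⟩ := exists_analyticAt_re_eventuallyEq hf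
  have hnorm : ∀ᶠ y in 𝓝 x, ‖Complex.exp (F y)‖ = Real.exp (f y) :=
    hre.mono fun y hy => by rw [Complex.norm_exp, ← hy]
  have hmax : IsLocalMax (norm ∘ fun ζ => Complex.exp (F ζ)) x := by
    filter_upwards [h, hnorm] with y hy hnormy
    simpa only [Function.comp, hnormy, hnorm.self_of_nhds] using Real.exp_le_exp.2 hy
  filter_upwards [hnorm, Complex.eventually_eq_of_isLocalMax_norm
    (hF.eventually_analyticAt.mono fun y hy => hy.differentiableAt.cexp) hmax] with y hnormy hy
  rw [← Real.exp_eq_exp, ← hnormy, ← hnorm.self_of_nhds, hy]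

end LocalMaximum

section CriticalPoints

theorem exists_mem_Ioc_eq_of_lt {β γ : ℝ → ℝ} {δ : ℝ} (hδ : 0 ≤ δ)
    (hβ : ContinuousOn β (Icc 0 δ)) (hγ : ContinuousOn γ (Icc 0 δ)) (h0 : β 0 = γ 0)
    (hβδ : β 0 < β δ) (hγδ : γ 0 < γ δ) : ∃ s ∈ Ioc 0 δ, ∃ t ∈ Ioc 0 δ, β s = γ t := by
  wlog hle : β δ ≤ γ δ generalizing β γ
  · obtain ⟨t, ht, s, hs, hst⟩ := this hγ hβ h0.symm hγδ hβδ (le_of_not_ge hle)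
    exact ⟨s, hs, t, ht, hst.symm⟩
  have hδ0 : δ ≠ 0 := by
    rintro rfl
    exact hβδ.false
  obtain ⟨t, ht, hγt⟩ := intermediate_value_Icc hδ hγ ⟨h0 ▸ hβδ.le, hle⟩
  refine ⟨δ, ⟨hδ.lt_of_ne' hδ0, le_rfl⟩, t, ⟨ht.1.lt_of_ne ?_, ht.2⟩, hγt.symm⟩
  rintro rfl
  exact hβδ.ne (h0.trans hγt)

theorem exists_ne_exists_mem_Ioc_eq {β : Fin 3 → ℝ → ℝ} {δ y : ℝ} (hδ : 0 ≤ δ)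
    (hc : ∀ i, ContinuousOn (β i) (Icc 0 δ)) (h0 : ∀ i, β i 0 = y) (hne : ∀ i, β i δ ≠ y) :
    ∃ i j, i ≠ j ∧ ∃ s ∈ Ioc 0 δ, ∃ t ∈ Ioc 0 δ, β i s = β j t := by
  obtain ⟨i, j, hij, hside⟩ := Fintype.exists_ne_map_eq_of_card_lt (fun i => decide (y < β i δ))
    (by simp)
  refine ⟨i, j, hij, ?_⟩
  rw [decide_eq_decide] at hside
  rcases (hne i).lt_or_gt with hi | hi
  · have hj : β j δ < y := (hne j).lt_of_le (not_lt.1 (hside.not.1 hi.not_gt))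
    simpa only [Pi.neg_apply, neg_inj] using exists_mem_Ioc_eq_of_lt hδ (hc i).neg (hc j).neg
      (by simp [h0]) (by simpa [h0]) (by simpa [h0])
  · exact exists_mem_Ioc_eq_of_lt hδ (hc i) (hc j) (by simp [h0]) (by simpa [h0])
      (by simpa [h0] using hside.1 hi)

theorem deriv_eq_zero_of_fderiv_re_eq_zero {F : ℂ → ℂ} {x : ℂ} (hF : DifferentiableAt ℂ F x)
    (h : fderiv ℝ (fun ζ => (F ζ).re) x = 0) : deriv F x = 0 := by
  have hre : HasFDerivAt (fun ζ => (F ζ).re) (Complex.reCLM.comp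
      ((ContinuousLinearMap.toSpanSingleton ℂ (deriv F x)).restrictScalars ℝ)) x :=
    Complex.reCLM.hasFDerivAt.comp x (hF.hasDerivAt.hasFDerivAt.restrictScalars ℝ)
  have hzero := hre.fderiv.symm.trans h
  have hone := DFunLike.congr_fun hzero 1
  have hI := DFunLike.congr_fun hzero Complex.I
  exact Complex.ext (by simpa using hone) (by simpa using hI)

theorem exists_openPartialHomeomorph_pow_eq {g : ℂ → ℂ} {x : ℂ} {n : ℕ} (hn : n ≠ 0)
    (hg : AnalyticAt ℂ g x) (hgx : g x ≠ 0) :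
    ∃ e : OpenPartialHomeomorph ℂ ℂ, x ∈ e.source ∧ e x = 0 ∧
      ∀ ζ, (ζ - x) ^ n * g ζ = e ζ ^ n := by
  set k : ℂ → ℂ := fun ζ => g x ^ (n : ℂ)⁻¹ * (g ζ / g x) ^ (n : ℂ)⁻¹ with hk
  have hkn : ∀ ζ, k ζ ^ n = g ζ := fun ζ => by
    rw [hk, mul_pow, Complex.cpow_nat_inv_pow _ hn, Complex.cpow_nat_inv_pow _ hn,
      mul_div_cancel₀ _ hgx]
  have hslit : g x / g x ∈ Complex.slitPlane := div_self hgx ▸ Complex.one_mem_slitPlane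
  have hka : AnalyticAt ℂ k x :=
    analyticAt_const.mul ((hg.div analyticAt_const hgx).cpow analyticAt_const hslit)
  have hkx : k x ≠ 0 := fun h => hgx (by rw [← hkn x, h, zero_pow hn])
  have hderiv : HasDerivAt (fun ζ => (ζ - x) * k ζ) (k x) x := by
    simpa using ((hasDerivAt_id x).sub_const x).fun_mul hka.differentiableAt.hasDerivAt
  have hstrict : HasStrictDerivAt (fun ζ => (ζ - x) * k ζ) (k x) x :=
    hderiv.deriv ▸ ((analyticAt_id.sub analyticAt_const).mul hka).hasStrictDerivAt
  have hequiv := hstrict.hasStrictFDerivAt_equiv hkx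
  exact ⟨hequiv.toOpenPartialHomeomorph _, hequiv.mem_toOpenPartialHomeomorph_source, by simp,
    fun ζ => by rw [HasStrictFDerivAt.toOpenPartialHomeomorph_coe, mul_pow, hkn]⟩

theorem exists_three_units_pow_re_eq_zero {n : ℕ} (hn : 2 ≤ n) :
    ∃ v : Fin 3 → ℂ, Function.Injective v ∧ (∀ i, ‖v i‖ = 1) ∧ ∀ i, (v i ^ n).re = 0 := by
  have hnR : (2 : ℝ) ≤ n := by exact_mod_cast hn
  have hpi := Real.pi_pos
  set θ : Fin 3 → ℝ := fun i => (i * Real.pi - Real.pi / 2) / n with hθ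
  have hmem : ∀ i, θ i ∈ Ioc (-Real.pi) Real.pi := fun i => by
    have hi : ((i : ℕ) : ℝ) ≤ 2 := by exact_mod_cast Nat.lt_succ_iff.1 i.2
    constructor
    · rw [hθ, lt_div_iff₀ (by linarith)]
      nlinarith [mul_nonneg (Nat.cast_nonneg' (i : ℕ) : (0 : ℝ) ≤ (i : ℕ)) hpi.le]
    · rw [hθ, div_le_iff₀ (by linarith)]
      nlinarith
  refine ⟨fun i => Complex.exp (θ i * Complex.I), fun i j hij => ?_,
    fun i => Complex.norm_exp_ofReal_mul_I _, fun i => ?_⟩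
  · have hexp := Complex.exp_inj_of_neg_pi_lt_of_le_pi (by simpa using (hmem i).1)
      (by simpa using (hmem i).2) (by simpa using (hmem j).1) (by simpa using (hmem j).2) hij
    have hθij : θ i = θ j := by simpa using hexp
    rw [hθ, div_left_inj' (by positivity), sub_left_inj, mul_left_inj' hpi.ne'] at hθij
    exact Fin.ext (by exact_mod_cast hθij)
  · have hangle : (n : ℂ) * (θ i * Complex.I) = (i * Real.pi - Real.pi / 2 : ℝ) * Complex.I := by
      have hn0 : (n : ℂ) ≠ 0 := Nat.cast_ne_zero.2 (by lia)
      simp only [hθ]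
      push_cast
      field_simp
    rw [← Complex.exp_nat_mul, hangle, Complex.exp_ofReal_mul_I_re, Real.cos_sub_pi_div_two,
      Real.sin_nat_mul_pi]

theorem exists_three_rays_re_eq {F : ℂ → ℂ} {x : ℂ} (hF : AnalyticAt ℂ F x) (hd : deriv F x = 0) :
    ∃ e : OpenPartialHomeomorph ℂ ℂ, x ∈ e.source ∧ e x = 0 ∧ ∃ v : Fin 3 → ℂ,
      Function.Injective v ∧ (∀ i, ‖v i‖ = 1) ∧
      ∀ᶠ ζ in 𝓝 x, ∀ i, ∀ s : ℝ, e ζ = s • v i → (F ζ).re = (F x).re := by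
  have horder : (2 : ℕ∞) ≤ analyticOrderAt (F · - F x) x := by
    rw [← hF.analyticOrderAt_deriv_add_one, ← one_add_one_eq_two]
    gcongr
    exact Order.one_le_iff_ne_zero.2 (hF.deriv.analyticOrderAt_ne_zero.2 hd)
  by_cases htop : analyticOrderAt (F · - F x) x = ⊤
  · obtain ⟨v, hinj, hnorm, -⟩ := exists_three_units_pow_re_eq_zero le_rfl
    refine ⟨(Homeomorph.subRight x).toOpenPartialHomeomorph, by simp, by simp, v, hinj, hnorm, ?_⟩
    exact (analyticOrderAt_eq_top.1 htop).mono fun ζ hζ _ _ _ => by rw [sub_eq_zero.1 hζ]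
  have hsub : AnalyticAt ℂ (F · - F x) x := hF.sub analyticAt_const
  obtain ⟨g, hg, hgx, hpow⟩ := hsub.analyticOrderAt_ne_top.1 htop
  set n := analyticOrderNatAt (F · - F x) x
  have hn : 2 ≤ n := by
    rw [← Nat.cast_analyticOrderNatAt htop] at horder
    exact_mod_cast horder
  obtain ⟨e, hxe, hex, he⟩ := exists_openPartialHomeomorph_pow_eq (n := n) (by lia) hg hgx
  obtain ⟨v, hinj, hnorm, hre⟩ := exists_three_units_pow_re_eq_zero hn
  refine ⟨e, hxe, hex, v, hinj, hnorm, hpow.mono fun ζ hζ i s hs => ?_⟩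
  have hF_sub : F ζ - F x = (ζ - x) ^ n * g ζ := hζ
  rw [← sub_eq_zero, ← Complex.sub_re, hF_sub, he, hs, smul_pow, Complex.smul_re, hre,
    smul_zero]

/- At a critical point the level set of `a` contains three arcs issuing from `x`. On it `b` is
injective, but a tripod does not embed into the line. -/
theorem fderiv_ne_zero_of_injOn {a b : ℂ → ℝ} {x : ℂ} (ha : HarmonicAt a x) {U : Set ℂ}
    (hU : U ∈ 𝓝 x) (hb : ContinuousOn b U) (hinj : InjOn (fun ζ => (a ζ, b ζ)) U) :
    fderiv ℝ a x ≠ 0 := by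
  intro hda
  obtain ⟨F, hF, hre⟩ := exists_analyticAt_re_eventuallyEq ha
  obtain ⟨e, hxe, hex, v, hv, hnorm, hrays⟩ := exists_three_rays_re_eq hF
    (deriv_eq_zero_of_fderiv_re_eq_zero hF.differentiableAt (hre.fderiv_eq.trans hda))
  have hlevel : ∀ᶠ ζ in 𝓝 x, ∀ i, ∀ s : ℝ, e ζ = s • v i → a ζ = a x := by
    filter_upwards [hrays, hre] with ζ hζ hreζ i s hs
    exact hreζ.symm.trans ((hζ i s hs).trans hre.self_of_nhds)
  have hsymm0 : e.symm 0 = x := by rw [← hex, e.left_inv hxe]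
  have h0t : (0 : ℂ) ∈ e.target := hex ▸ e.map_source hxe
  have htend : Tendsto e.symm (𝓝 0) (𝓝 x) := hsymm0 ▸ (e.continuousAt_symm h0t).tendsto
  obtain ⟨δ, hδ, hball⟩ := Metric.nhds_basis_closedBall.eventually_iff.1
    ((e.open_target.eventually_mem h0t).and (htend.eventually (hlevel.and hU)))
  have hmem : ∀ i, ∀ s ∈ Icc 0 δ, s • v i ∈ Metric.closedBall (0 : ℂ) δ := fun i s hs => by
    rw [mem_closedBall_zero_iff, norm_smul, hnorm, mul_one, Real.norm_of_nonneg hs.1]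
    exact hs.2
  have heq : ∀ i j, ∀ s ∈ Icc 0 δ, ∀ t ∈ Icc 0 δ, b (e.symm (s • v i)) = b (e.symm (t • v j)) →
      s • v i = t • v j := fun i j s hs t ht hst => by
    obtain ⟨htgt, hlev, hUs⟩ := hball (hmem i s hs)
    obtain ⟨htgt', hlev', hUt⟩ := hball (hmem j t ht)
    refine e.symm.injOn htgt htgt' (hinj hUs hUt (Prod.ext ?_ hst))
    exact (hlev i s (e.right_inv htgt)).trans (hlev' j t (e.right_inv htgt')).symm
  have hne : ∀ i, v i ≠ 0 := fun i => norm_ne_zero_iff.1 (by simp [hnorm])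
  obtain ⟨i, j, hij, s, hs, t, ht, hst⟩ := exists_ne_exists_mem_Ioc_eq
    (β := fun i s => b (e.symm (s • v i))) hδ.le
    (fun i => hb.comp (e.continuousOn_symm.comp (by fun_prop) fun s hs => (hball (hmem i s hs)).1)
      fun s hs => (hball (hmem i s hs)).2.2)
    (fun i => by rw [zero_smul, hsymm0]) fun i h => by
      have := heq i i δ ⟨hδ.le, le_rfl⟩ 0 ⟨le_rfl, hδ.le⟩ (by rwa [zero_smul, hsymm0])
      simp [hδ.ne', hne] at this
  have hsv := heq i j s ⟨hs.1.le, hs.2⟩ t ⟨ht.1.le, ht.2⟩ hst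
  have hst' : s = t := by
    simpa [norm_smul, hnorm, abs_of_pos hs.1, abs_of_pos ht.1] using congrArg norm hsv
  exact hij (hv (smul_right_injective ℂ hs.1.ne' (hst' ▸ hsv)))

end CriticalPoints

section InvarianceOfDomain

theorem exists_eq_zero_of_eq_self_on_sphere {F : ℂ → ℂ} {ρ : ℝ} (hρ : 0 < ρ) (hF : Continuous F)
    (hs : ∀ ζ, ‖ζ‖ = ρ → F ζ = ζ) : ∃ ζ, F ζ = 0 := by
  by_contra! hne
  obtain ⟨L, ⟨-, hL⟩, -⟩ := Complex.isCoveringMapOn_exp.existsUnique_continuousMap_lifts ⟨F, hF⟩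
    (a₀ := 0) (e₀ := Complex.log (F 0)) (Complex.exp_log (hne 0)) hne
  set c : ℝ → ℂ := fun θ => ρ * Complex.exp (θ * Complex.I) with hc
  have hFc : ∀ θ, F (c θ) = c θ := fun θ => hs _ (by
    rw [hc, norm_mul, Complex.norm_exp_ofReal_mul_I, mul_one, Complex.norm_of_nonneg hρ.le])
  have hlift : ∀ θ, Complex.exp (L (c θ)) = c θ := fun θ => (congrFun hL (c θ)).trans (hFc θ)
  have hcover : (fun θ => L (c θ)) = fun θ : ℝ => L (c 0) + θ * Complex.I := by
    refine Complex.isCoveringMap_exp.eq_of_comp_eq (by fun_prop) (by fun_prop) ?_ 0 (by simp)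
    ext θ
    simp only [Function.comp, Complex.exp_add, hlift]
    simp [hc]
  have hloop := congrFun hcover (2 * Real.pi)
  have hperiod : c (2 * Real.pi) = c 0 := by simp [hc]
  simp [hperiod, Real.pi_ne_zero] at hloop

theorem ball_subset_image_closedBall {H : ℂ → ℂ} {w₀ : ℂ} {ρ : ℝ}
    (hH : ContinuousOn H (Metric.closedBall w₀ ρ)) (hs : ∀ w ∈ Metric.sphere w₀ ρ, H w = w) :
    Metric.ball w₀ ρ ⊆ H '' Metric.closedBall w₀ ρ := by
  classical
  intro a ha
  have hρ : 0 < ρ := dist_nonneg.trans_lt ha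
  set G : ℂ → ℂ := (Metric.closedBall w₀ ρ).piecewise H id with hG
  have hGc : Continuous G := by
    rw [← continuousOn_univ, ← union_compl_self (Metric.ball w₀ ρ)]
    have hout : EqOn G id (Metric.ball w₀ ρ)ᶜ := fun w hw => by
      by_cases h : w ∈ Metric.closedBall w₀ ρ
      · rw [hG, piecewise_eq_of_mem _ _ _ h, id]
        exact hs w (le_antisymm h (not_lt.1 hw))
      · exact piecewise_eq_of_notMem _ _ _ h
    have hin : ContinuousOn G (Metric.closedBall w₀ ρ) :=
      hH.congr (piecewise_eqOn _ _ _)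
    exact (hin.union_of_isClosed (continuousOn_id.congr hout) Metric.isClosed_closedBall
      Metric.isOpen_ball.isClosed_compl).mono
        (union_subset_union_left _ Metric.ball_subset_closedBall)
  obtain ⟨ζ, hζ⟩ := exists_eq_zero_of_eq_self_on_sphere (F := fun ζ => G (a + ζ) - a)
    (ρ := 2 * ρ) (by positivity) (by fun_prop) fun ζ hζ => by
      have hfar : a + ζ ∉ Metric.closedBall w₀ ρ := fun h => by
        have h2 := dist_triangle_right (a + ζ) a w₀
        rw [dist_self_add_left] at h2
        linarith [Metric.mem_closedBall.1 h, Metric.mem_ball.1 ha]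
      rw [hG, piecewise_eq_of_notMem _ _ _ hfar, id, add_sub_cancel_left]
  rw [sub_eq_zero] at hζ
  by_cases hmem : a + ζ ∈ Metric.closedBall w₀ ρ
  · exact ⟨a + ζ, hmem, by rwa [hG, piecewise_eq_of_mem _ _ _ hmem] at hζ⟩
  · rw [hG, piecewise_eq_of_notMem _ _ _ hmem, id] at hζ
    exact absurd (Metric.ball_subset_closedBall ha) (hζ ▸ hmem)

variable {E : Type*} [NormedAddCommGroup E] [NormedSpace ℝ E]

/-- The radial push from `p` onto the complement of the open ball of radius `ε`: points at distance
at least `ε` from `p` stay fixed, the others move to the sphere. -/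
def pushOut (p : E) (ε : ℝ) (y : E) : E := p + max 1 (ε / dist y p) • (y - p)

theorem continuousOn_pushOut (p : E) (ε : ℝ) : ContinuousOn (pushOut p ε) {p}ᶜ := by
  have hdiv : ContinuousOn (fun y => ε / dist y p) {p}ᶜ :=
    continuousOn_const.div (by fun_prop) fun y hy => dist_ne_zero.2 hy
  exact continuousOn_const.add ((continuousOn_const.sup hdiv).smul (by fun_prop))

theorem pushOut_of_le_dist {p y : E} {ε : ℝ} (h : ε ≤ dist y p) : pushOut p ε y = y := by
  rw [pushOut, max_eq_left (div_le_one_of_le₀ h dist_nonneg), one_smul, add_sub_cancel]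

theorem pushOut_mem_sphere {p y : E} {ε : ℝ} (hy : y ≠ p) (h : dist y p ≤ ε) :
    pushOut p ε y ∈ Metric.sphere p ε := by
  have hd := dist_pos.2 hy
  rw [mem_sphere_iff_norm, pushOut, add_sub_cancel_left, max_eq_right ((one_le_div hd).2 h),
    norm_smul, ← dist_eq_norm, Real.norm_of_nonneg (div_nonneg (hd.le.trans h) hd.le),
    div_mul_cancel₀ _ hd.ne']

/- Otherwise `q ∘ pushOut p ε ∘ φ` would be the identity on the boundary circle and omit `a`. -/
theorem mem_image_sphere_of_dist_lt {φ : ℂ → E} {q : E → ℂ} {w₀ a : ℂ} {p : E} {ρ ε : ℝ}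
    (hφ : ContinuousOn φ (Metric.closedBall w₀ ρ)) {W : Set E}
    (hφW : MapsTo φ (Metric.closedBall w₀ ρ) W) (hq : ContinuousOn q W)
    (hinv : ∀ w ∈ Metric.closedBall w₀ ρ, q (φ w) = w) (hp : p ∉ φ '' Metric.closedBall w₀ ρ)
    (hε : Metric.sphere p ε ⊆ W) (hs : ∀ w ∈ Metric.sphere w₀ ρ, ε ≤ dist (φ w) p)
    (ha : a ∈ Metric.ball w₀ ρ) (hpa : dist (φ a) p < ε) : a ∈ q '' Metric.sphere p ε := by
  have hne : ∀ w ∈ Metric.closedBall w₀ ρ, φ w ≠ p := fun w hw h => hp ⟨w, hw, h⟩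
  have hmaps : MapsTo (fun w => pushOut p ε (φ w)) (Metric.closedBall w₀ ρ) W := fun w hw => by
    rcases le_total ε (dist (φ w) p) with h | h
    · simpa only [pushOut_of_le_dist h] using hφW hw
    · exact hε (pushOut_mem_sphere (hne w hw) h)
  obtain ⟨w, hw, hqw⟩ := ball_subset_image_closedBall
    (hq.comp ((continuousOn_pushOut p ε).comp hφ hne) hmaps)
    (fun w hw => by
      simp only [Function.comp, pushOut_of_le_dist (hs w hw),
        hinv w (Metric.sphere_subset_closedBall hw)]) ha
  rcases lt_or_ge (dist (φ w) p) ε with h | h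
  · exact ⟨_, pushOut_mem_sphere (hne w hw) h.le, hqw⟩
  · simp only [Function.comp, pushOut_of_le_dist h, hinv w hw] at hqw
    exact absurd hpa (hqw ▸ h.not_gt)

theorem image_closedBall_mem_nhds {φ q : ℂ → ℂ} {w₀ : ℂ} {ρ : ℝ} (hρ : 0 < ρ)
    (hφ : ContinuousOn φ (Metric.closedBall w₀ ρ)) {W : Set ℂ} (hW : IsOpen W)
    (hφW : MapsTo φ (Metric.closedBall w₀ ρ) W) (hq : DifferentiableOn ℝ q W)
    (hinv : ∀ w ∈ Metric.closedBall w₀ ρ, q (φ w) = w) :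
    φ '' Metric.closedBall w₀ ρ ∈ 𝓝 (φ w₀) := by
  by_contra hn
  have hw₀ : w₀ ∈ Metric.closedBall w₀ ρ := Metric.mem_closedBall_self hρ.le
  have hsphere : IsCompact (φ '' Metric.sphere w₀ ρ) :=
    (isCompact_sphere w₀ ρ).image_of_continuousOn (hφ.mono Metric.sphere_subset_closedBall)
  have hnotMem : φ w₀ ∉ φ '' Metric.sphere w₀ ρ := by
    rintro ⟨w, hw, h⟩
    have hww₀ : w = w₀ := LeftInvOn.injOn hinv (Metric.sphere_subset_closedBall hw) hw₀ h
    rw [hww₀, Metric.mem_sphere, dist_self] at hw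
    exact hρ.ne hw
  obtain ⟨ε, hε, hball⟩ := Metric.mem_nhds_iff.1
    ((hW.inter hsphere.isClosed.isOpen_compl).mem_nhds ⟨hφW hw₀, hnotMem⟩)
  obtain ⟨p, hp, hpK⟩ : ∃ p ∈ Metric.ball (φ w₀) (ε / 2), p ∉ φ '' Metric.closedBall w₀ ρ := by
    by_contra! h
    exact hn (mem_of_superset (Metric.ball_mem_nhds _ (half_pos hε)) h)
  have hnear : ∀ y, dist y p < ε / 2 → y ∈ Metric.ball (φ w₀) ε := fun y hy => by
    rw [Metric.mem_ball] at hp ⊢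
    linarith [dist_triangle y p (φ w₀)]
  have hpW : Metric.sphere p (ε / 2) ⊆ W := fun y hy => (hball (by
    rw [Metric.mem_ball, Metric.mem_sphere] at *
    linarith [dist_triangle y p (φ w₀)])).1
  have hcover : ∀ᶠ a in 𝓝 w₀, a ∈ q '' Metric.sphere p (ε / 2) := by
    have hclose : ∀ᶠ a in 𝓝 w₀, dist (φ a) p < ε / 2 :=
      ((hφ.continuousAt (Metric.closedBall_mem_nhds w₀ hρ)).dist continuousAt_const).eventually_lt
        continuousAt_const (by rwa [dist_comm])
    filter_upwards [hclose, Metric.ball_mem_nhds w₀ hρ] with a hpa ha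
    refine mem_image_sphere_of_dist_lt hφ hφW hq.continuousOn hinv hpK hpW (fun w hw => ?_) ha hpa
    by_contra! h
    exact (hball (hnear _ h)).2 (mem_image_of_mem φ hw)
  have hnull : MeasureTheory.volume (q '' Metric.sphere p (ε / 2)) = 0 :=
    MeasureTheory.addHaar_image_eq_zero_of_differentiableOn_of_addHaar_eq_zero _ (hq.mono hpW)
      (MeasureTheory.Measure.addHaar_sphere _ _ _)
  exact (MeasureTheory.Measure.measure_pos_of_mem_nhds _ hcover).ne' hnull

end InvarianceOfDomain

section Primitive

variable {E F : Type*} [NormedAddCommGroup E] [NormedSpace ℝ E] [NormedAddCommGroup F]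
  [NormedSpace ℝ F]

theorem exists_hasFDerivAt_of_starConvex [CompleteSpace F] {O : Set E} {a : E} (hO : IsOpen O)
    (hstar : StarConvex ℝ a O) {η : E → E →L[ℝ] F} {η' : E → E →L[ℝ] E →L[ℝ] F}
    (hη : ∀ x ∈ O, HasFDerivAt η (η' x) x) (hsymm : ∀ x ∈ O, ∀ v w, η' x v w = η' x w v) :
    ∃ Q : E → F, ∀ x ∈ O, HasFDerivAt Q (η x) x := by
  refine ⟨fun x => curveIntegral η (.segment a x), fun x hx => ?_⟩
  obtain ⟨r, hr, hball⟩ := Metric.isOpen_iff.1 hO x hx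
  have hadd : ∀ y ∈ Metric.ball x r, curveIntegral η (.segment a y) =
      curveIntegral η (.segment a x) + curveIntegral η (.segment x y) := fun y hy => by
    have hsO : convexHull ℝ {a, x, y} ⊆ O := by
      rw [convexHull_insert (by simp), convexHull_pair]
      intro z hz
      obtain ⟨_, rfl, v, hv, hz⟩ := mem_convexJoin.1 hz
      exact starConvex_iff_segment_subset.1 hstar
        (hball ((convex_ball x r).segment_subset (Metric.mem_ball_self hr) hy hv)) hz
    have hsub := subset_convexHull ℝ ({a, x, y} : Set E)
    exact ((convex_convexHull ℝ _).curveIntegral_segment_add_eq_of_hasFDerivWithinAt_symmetric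
      (fun z hz => (hη z (hsO hz)).hasFDerivWithinAt) (fun z hz v _ w _ => hsymm z (hsO hz) v w)
      (hsub (by simp)) (hsub (by simp)) (hsub (by simp))).symm
  have hlocal : HasFDerivAt (fun y => curveIntegral η (.segment x y)) (η x) x :=
    HasFDerivAt.curveIntegral_segment_source' ((hO.eventually_mem hx).mono fun z hz =>
      (hη z hz).continuousAt)
  exact (hlocal.const_add _).congr_of_eventuallyEq
    (eventuallyEq_of_mem (Metric.ball_mem_nhds x hr) hadd)

theorem eventually_sub_eq_of_eventually_hasFDerivAt {f g : E → F} {g' : E → E →L[ℝ] F} {x : E}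
    (hf : ∀ᶠ y in 𝓝 x, HasFDerivAt f (g' y) y) (hg : ∀ᶠ y in 𝓝 x, HasFDerivAt g (g' y) y) :
    ∀ᶠ y in 𝓝 x, f y - g y = f x - g x := by
  obtain ⟨r, hr, hball⟩ := Metric.eventually_nhds_iff_ball.1 (hf.and hg)
  have hsub (y : E) (hy : y ∈ Metric.ball x r) : HasFDerivAt (f - g) 0 y :=
    ((hball y hy).1.sub (hball y hy).2).congr_fderiv (sub_self _)
  filter_upwards [Metric.ball_mem_nhds x hr] with y hy
  exact Metric.isOpen_ball.is_const_of_fderiv_eq_zero (𝕜 := ℝ) Metric.isPreconnected_ball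
    (fun z hz => (hsub z hz).differentiableAt.differentiableWithinAt)
    (fun z hz => (hsub z hz).fderiv) hy (Metric.mem_ball_self hr)

theorem exists_eventually_sub_eq_of_local_potentials [CompleteSpace F] {O : Set E} {a : E}
    (hO : IsOpen O) (hstar : StarConvex ℝ a O) {P : E → E → F}
    (hP : ∀ x ∈ O, ContDiffAt ℝ 2 (P x) x)
    (hPP : ∀ x ∈ O, ∀ᶠ y in 𝓝 x, ∀ᶠ z in 𝓝 y, P y z - P x z = P y y - P x y) :
    ∃ Q : E → F, ∀ x ∈ O, ∀ᶠ y in 𝓝 x, Q y - P x y = Q x - P x x := by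
  have hfderiv (x) (hx : x ∈ O) : ∀ᶠ y in 𝓝 x, fderiv ℝ (P y) y = fderiv ℝ (P x) y :=
    (hPP x hx).mono fun y hy => by
      have hconst : P y =ᶠ[𝓝 y] fun z => P y y - P x y + P x z :=
        hy.mono fun z hz => sub_eq_iff_eq_add.1 hz
      rw [hconst.fderiv_eq, fderiv_const_add]
  have hdiff (x) (hx : x ∈ O) : ∀ᶠ y in 𝓝 x, HasFDerivAt (P x) (fderiv ℝ (P x) y) y :=
    ((hP x hx).eventually (by simp)).mono fun y hy => (hy.differentiableAt two_ne_zero).hasFDerivAt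
  obtain ⟨Q, hQ⟩ := exists_hasFDerivAt_of_starConvex hO hstar (η := fun x => fderiv ℝ (P x) x)
    (fun x hx => (((hP x hx).fderiv_right (m := 1) le_rfl).differentiableAt
      one_ne_zero).hasFDerivAt.congr_of_eventuallyEq (hfderiv x hx))
    fun x hx => (hP x hx).isSymmSndFDerivAt (by simp)
  refine ⟨Q, fun x hx => eventually_sub_eq_of_eventually_hasFDerivAt ?_ (hdiff x hx)⟩
  filter_upwards [hO.eventually_mem hx, hfderiv x hx] with y hy hxy
  exact hxy ▸ hQ y hy

end Primitive

section ChainRule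

variable {E G : Type*} [NormedAddCommGroup E] [NormedAddCommGroup G] [NormedSpace ℝ G]

theorem hasFDerivAt_fderiv_apply [NormedSpace ℝ E] {F : E → G} {x : E} (hF : ContDiffAt ℝ 2 F x)
    (v : E) : HasFDerivAt (fun y => fderiv ℝ F y v)
      ((ContinuousLinearMap.apply ℝ G v).comp (fderiv ℝ (fderiv ℝ F) x)) x :=
  (ContinuousLinearMap.apply ℝ G v).hasFDerivAt.comp x
    ((hF.fderiv_right (m := 1) le_rfl).differentiableAt one_ne_zero).hasFDerivAt

variable [InnerProductSpace ℝ E] [FiniteDimensional ℝ E]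

theorem laplacian_comp {g : ℝ → ℝ} {f : E → ℝ} {x : E} (hg : ContDiffAt ℝ 2 g (f x))
    (hf : ContDiffAt ℝ 2 f x) :
    Δ (g ∘ f) x = deriv (deriv g) (f x) * ‖fderiv ℝ f x‖ ^ 2 + deriv g (f x) * Δ f x := by
  have hfderiv : fderiv ℝ (g ∘ f) =ᶠ[𝓝 x] fun y => deriv g (f y) • fderiv ℝ f y := by
    filter_upwards [hf.eventually (by simp), hf.continuousAt.eventually (hg.eventually (by simp))]
      with y hfy hgy
    exact ((hgy.differentiableAt two_ne_zero).hasDerivAt.comp_hasFDerivAt y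
      (hfy.differentiableAt two_ne_zero).hasFDerivAt).fderiv
  have hdg : HasDerivAt (deriv g) (deriv (deriv g) (f x)) (f x) := by
    have hd : DifferentiableAt ℝ (fun y => fderiv ℝ g y 1) (f x) :=
      (hasFDerivAt_fderiv_apply hg 1).differentiableAt
    simp only [fderiv_apply_one_eq_deriv] at hd
    exact hd.hasDerivAt
  have hsecond : HasFDerivAt (fun y => deriv g (f y) • fderiv ℝ f y) _ x :=
    (hdg.comp_hasFDerivAt x (hf.differentiableAt two_ne_zero).hasFDerivAt).fun_smul
      ((hf.fderiv_right (m := 1) le_rfl).differentiableAt one_ne_zero).hasFDerivAt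
  simp only [laplacian_eq_iteratedFDeriv_stdOrthonormalBasis, iteratedFDeriv_two_apply,
    hfderiv.fderiv_eq, hsecond.fderiv, (stdOrthonormalBasis ℝ E).norm_dual, Finset.mul_sum,
    ← Finset.sum_add_distrib]
  refine Finset.sum_congr rfl fun i _ => ?_
  simp
  ring

theorem laplacian_sq {f : E → ℝ} {x : E} (hf : ContDiffAt ℝ 2 f x) :
    Δ (fun y => f y ^ 2) x = 2 * ‖fderiv ℝ f x‖ ^ 2 + 2 * f x * Δ f x := by
  have h := laplacian_comp (g := fun s => s ^ 2) (contDiff_id.pow 2).contDiffAt hf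
  have hd : deriv (fun s : ℝ => s ^ 2) = fun s => 2 * s := by ext s; simp
  have hdd : deriv (fun s : ℝ => 2 * s) (f x) = 2 := by simp
  rw [hd, hdd] at h
  exact h

theorem laplacian_log {f : E → ℝ} {x : E} (hf : ContDiffAt ℝ 2 f x) (hx : f x ≠ 0) :
    Δ (fun y => Real.log (f y)) x = Δ f x / f x - ‖fderiv ℝ f x‖ ^ 2 / f x ^ 2 := by
  have h := laplacian_comp (Real.contDiffAt_log.2 hx) hf
  simp only [Real.deriv_log', deriv_inv] at h
  refine h.trans ?_
  field_simp
  ring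

theorem laplacian_half_log_add_sq {a c : E → ℝ} {x : E} (ha : ContDiffAt ℝ 2 a x)
    (hc : ContDiffAt ℝ 2 c x) (hΔa : Δ a x = 0) (hΔc : Δ c x = 0) (hx : a x ^ 2 + c x ^ 2 ≠ 0) :
    Δ (fun y => 1 / 2 * Real.log (a y ^ 2 + c y ^ 2)) x =
      ((‖fderiv ℝ a x‖ ^ 2 + ‖fderiv ℝ c x‖ ^ 2) * (a x ^ 2 + c x ^ 2) -
        2 * ‖a x • fderiv ℝ a x + c x • fderiv ℝ c x‖ ^ 2) / (a x ^ 2 + c x ^ 2) ^ 2 := by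
  have hρ : ContDiffAt ℝ 2 (fun y => a y ^ 2 + c y ^ 2) x := (ha.pow 2).add (hc.pow 2)
  have hΔρ : Δ (fun y => a y ^ 2 + c y ^ 2) x = 2 * (‖fderiv ℝ a x‖ ^ 2 + ‖fderiv ℝ c x‖ ^ 2) := by
    change Δ ((fun y => a y ^ 2) + fun y => c y ^ 2) x = _
    rw [(ha.pow 2).laplacian_add (hc.pow 2), laplacian_sq ha, laplacian_sq hc, hΔa, hΔc]
    ring
  have hdρ : fderiv ℝ (fun y => a y ^ 2 + c y ^ 2) x =
      (2 : ℝ) • (a x • fderiv ℝ a x + c x • fderiv ℝ c x) := by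
    have had := ha.differentiableAt two_ne_zero
    have hcd := hc.differentiableAt two_ne_zero
    rw [fderiv_fun_add (had.fun_pow 2) (hcd.fun_pow 2), fderiv_fun_pow 2 had, fderiv_fun_pow 2 hcd]
    ext v
    simp
    ring
  change Δ ((1 / 2 : ℝ) • fun y => Real.log (a y ^ 2 + c y ^ 2)) x = _
  rw [laplacian_smul _ (hρ.log hx), laplacian_log hρ hx, hΔρ, hdρ, norm_smul]
  simp only [smul_eq_mul, Real.norm_ofNat, mul_pow]
  field_simp

end ChainRule

section EuclideanThreeSpace

theorem inner_eq_sum (a b : E3) : inner ℝ a b = a 0 * b 0 + a 1 * b 1 + a 2 * b 2 := by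
  simp [PiLp.inner_apply, Fin.sum_univ_three, mul_comm]

theorem inner_cross_self (a b : E3) : inner ℝ (cross a b) (cross a b) =
    inner ℝ a a * inner ℝ b b - inner ℝ a b ^ 2 := by
  simp only [inner_eq_sum, cross, cross_apply, Matrix.cons_val]
  ring

theorem cross_cross (l a b : E3) : cross l (cross a b) = inner ℝ l b • a - inner ℝ l a • b := by
  ext i
  fin_cases i <;> simp [inner_eq_sum, cross, cross_apply] <;> ring

theorem eq_zero_of_inner_cross {a b l : E3} (hab : cross a b ≠ 0) (ha : inner ℝ l a = 0)
    (hb : inner ℝ l b = 0) (hc : inner ℝ l (cross a b) = 0) : l = 0 := by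
  have hcross : cross l (cross a b) = 0 := by
    rw [cross_cross, ha, hb, zero_smul, zero_smul, sub_zero]
  have hmul := inner_cross_self l (cross a b)
  rw [hcross, hc, inner_zero_left, zero_pow two_ne_zero, sub_zero] at hmul
  simpa [hab] using hmul.symm

end EuclideanThreeSpace

section ConformalSurface

/-- `F` is weakly conformal at `x` if the coefficients of its first fundamental form satisfy
`E = G` and `F = 0`; in contrast to `ConformalAt`, the derivative may vanish. -/
def IsWeaklyConformalAt (F : ℂ → E3) (x : ℂ) : Prop :=
  inner ℝ (du F x) (du F x) = inner ℝ (dv F x) (dv F x) ∧ inner ℝ (du F x) (dv F x) = 0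

variable {F : ℂ → E3} {x : ℂ}

theorem isWeaklyConformalAt_of_conformalAt (h : ConformalAt F x) : IsWeaklyConformalAt F x := by
  obtain ⟨c, -, hc⟩ := conformalAt_iff'.1 h
  simp only [IsWeaklyConformalAt, du, dv, hc]
  simp

theorem du_ne_zero_of_conformalAt (h : ConformalAt F x) : du F x ≠ 0 := by
  obtain ⟨c, hc, hinner⟩ := conformalAt_iff'.1 h
  rw [← inner_self_ne_zero (𝕜 := ℝ), du, hinner]
  simpa using hc.ne'

theorem laplacian_eq_du_du_add_dv_dv (hF : ContDiffAt ℝ 2 F x) :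
    Δ F x = du (du F) x + dv (dv F) x := by
  have hdu : fderiv ℝ (du F) x = _ := (hasFDerivAt_fderiv_apply hF 1).fderiv
  have hdv : fderiv ℝ (dv F) x = _ := (hasFDerivAt_fderiv_apply hF Complex.I).fderiv
  rw [du, hdu, dv, hdv, laplacian_eq_iteratedFDeriv_complexPlane]
  simp [iteratedFDeriv_two_apply]

theorem du_dv_eq_dv_du (hF : ContDiffAt ℝ 2 F x) : du (dv F) x = dv (du F) x := by
  have hdu : fderiv ℝ (du F) x = _ := (hasFDerivAt_fderiv_apply hF 1).fderiv
  have hdv : fderiv ℝ (dv F) x = _ := (hasFDerivAt_fderiv_apply hF Complex.I).fderiv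
  rw [du, hdv, dv, hdu]
  exact hF.isSymmSndFDerivAt (by simp) 1 Complex.I

theorem inner_fderiv_du_eq_inner_fderiv_dv (hF : ContDiffAt ℝ 2 F x)
    (hw : ∀ᶠ ζ in 𝓝 x, IsWeaklyConformalAt F ζ) (v : ℂ) :
    inner ℝ (fderiv ℝ (du F) x v) (du F x) = inner ℝ (fderiv ℝ (dv F) x v) (dv F x) := by
  have hdu : DifferentiableAt ℝ (du F) x := (hasFDerivAt_fderiv_apply hF 1).differentiableAt
  have hdv : DifferentiableAt ℝ (dv F) x := (hasFDerivAt_fderiv_apply hF Complex.I).differentiableAt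
  have heq : (fun ζ => inner ℝ (du F ζ) (du F ζ)) =ᶠ[𝓝 x] fun ζ => inner ℝ (dv F ζ) (dv F ζ) :=
    hw.mono fun ζ h => h.1
  have h := DFunLike.congr_fun (heq.fderiv_eq (𝕜 := ℝ)) v
  rw [fderiv_inner_apply ℝ hdu hdu, fderiv_inner_apply ℝ hdv hdv,
    real_inner_comm (fderiv ℝ (du F) x v), real_inner_comm (fderiv ℝ (dv F) x v)] at h
  linarith

theorem inner_fderiv_du_add_inner_fderiv_dv (hF : ContDiffAt ℝ 2 F x)
    (hw : ∀ᶠ ζ in 𝓝 x, IsWeaklyConformalAt F ζ) (v : ℂ) :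
    inner ℝ (fderiv ℝ (du F) x v) (dv F x) + inner ℝ (fderiv ℝ (dv F) x v) (du F x) = 0 := by
  have hdu : DifferentiableAt ℝ (du F) x := (hasFDerivAt_fderiv_apply hF 1).differentiableAt
  have hdv : DifferentiableAt ℝ (dv F) x := (hasFDerivAt_fderiv_apply hF Complex.I).differentiableAt
  have heq : (fun ζ => inner ℝ (du F ζ) (dv F ζ)) =ᶠ[𝓝 x] fun _ => 0 := hw.mono fun ζ h => h.2
  have h := DFunLike.congr_fun (heq.fderiv_eq (𝕜 := ℝ)) v
  rw [fderiv_inner_apply ℝ hdu hdv, real_inner_comm (fderiv ℝ (dv F) x v), add_comm] at h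
  simpa using h

theorem inner_laplacian_du_eq_zero (hF : ContDiffAt ℝ 2 F x)
    (hw : ∀ᶠ ζ in 𝓝 x, IsWeaklyConformalAt F ζ) : inner ℝ (Δ F x) (du F x) = 0 := by
  have hu : inner ℝ (du (du F) x) (du F x) = inner ℝ (du (dv F) x) (dv F x) :=
    inner_fderiv_du_eq_inner_fderiv_dv hF hw 1
  have hv : inner ℝ (dv (du F) x) (dv F x) + inner ℝ (dv (dv F) x) (du F x) = 0 :=
    inner_fderiv_du_add_inner_fderiv_dv hF hw Complex.I
  rw [laplacian_eq_du_du_add_dv_dv hF, inner_add_left, hu, du_dv_eq_dv_du hF, hv]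

theorem inner_laplacian_dv_eq_zero (hF : ContDiffAt ℝ 2 F x)
    (hw : ∀ᶠ ζ in 𝓝 x, IsWeaklyConformalAt F ζ) : inner ℝ (Δ F x) (dv F x) = 0 := by
  have hu : inner ℝ (du (du F) x) (dv F x) + inner ℝ (du (dv F) x) (du F x) = 0 :=
    inner_fderiv_du_add_inner_fderiv_dv hF hw 1
  have hv : inner ℝ (dv (du F) x) (du F x) = inner ℝ (dv (dv F) x) (dv F x) :=
    inner_fderiv_du_eq_inner_fderiv_dv hF hw Complex.I
  rw [laplacian_eq_du_du_add_dv_dv hF, inner_add_left, ← hv, ← du_dv_eq_dv_du hF, hu]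

theorem meanCurvature_eq_inner_laplacian_div (hF : ContDiffAt ℝ 2 F x)
    (hw : IsWeaklyConformalAt F x) : meanCurvature F x =
      inner ℝ (Δ F x) (unitNormal F x) / (2 * inner ℝ (du F x) (du F x)) := by
  rw [meanCurvature, laplacian_eq_du_du_add_dv_dv hF, ← hw.1, hw.2, inner_add_left]
  generalize inner ℝ (du F x) (du F x) = E
  rcases eq_or_ne E 0 with rfl | hE
  · simp
  · field_simp
    ring

theorem laplacian_eq_zero_of_meanCurvature_eq_zero (hF : ContDiffAt ℝ 2 F x)
    (hc : ∀ᶠ ζ in 𝓝 x, ConformalAt F ζ) (hH : meanCurvature F x = 0) : Δ F x = 0 := by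
  have hw : ∀ᶠ ζ in 𝓝 x, IsWeaklyConformalAt F ζ :=
    hc.mono fun ζ h => isWeaklyConformalAt_of_conformalAt h
  have hwx := hw.self_of_nhds
  have hE : inner ℝ (du F x) (du F x) ≠ 0 :=
    inner_self_ne_zero.2 (du_ne_zero_of_conformalAt hc.self_of_nhds)
  have hcross : cross (du F x) (dv F x) ≠ 0 := by
    rw [← inner_self_ne_zero (𝕜 := ℝ), inner_cross_self, ← hwx.1, hwx.2]
    simpa using hE
  refine eq_zero_of_inner_cross hcross (inner_laplacian_du_eq_zero hF hw)
    (inner_laplacian_dv_eq_zero hF hw) ?_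
  rw [meanCurvature_eq_inner_laplacian_div hF hwx] at hH
  simpa [du_ne_zero_of_conformalAt hc.self_of_nhds, unitNormal, inner_smul_right, hcross] using hH

end ConformalSurface

section SlabBarrier

theorem sq_norm_eq_add_sq (L : ℂ →L[ℝ] ℝ) : ‖L‖ ^ 2 = L 1 ^ 2 + L Complex.I ^ 2 := by
  simp [Complex.orthonormalBasisOneI.norm_dual]

theorem sq_inner_add_sq_inner_le {E : Type*} [NormedAddCommGroup E] [InnerProductSpace ℝ E]
    {u v : E} (huv : ‖u‖ = ‖v‖) (horth : inner ℝ u v = 0) (n : E) :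
    inner ℝ n u ^ 2 + inner ℝ n v ^ 2 ≤ ‖n‖ ^ 2 * ‖u‖ ^ 2 := by
  set w := inner ℝ n u • u + inner ℝ n v • v with hw
  set s := inner ℝ n u ^ 2 + inner ℝ n v ^ 2 with hs
  have hnw : inner ℝ n w = s := by
    rw [hw, inner_add_right, inner_smul_right, inner_smul_right, hs, sq, sq]
  have hww : ‖w‖ ^ 2 = s * ‖u‖ ^ 2 := by
    rw [hw, norm_add_sq_real, norm_smul, norm_smul, ← huv, inner_smul_left, inner_smul_right, horth]
    simp [mul_pow, hs]
    ring
  have hs0 : 0 ≤ s := by positivity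
  rcases hs0.eq_or_lt with hzero | hpos
  · rw [← hzero]
    positivity
  · refine le_of_mul_le_mul_left ?_ hpos
    calc s * s = inner ℝ n w ^ 2 := by rw [hnw, sq]
      _ ≤ (‖n‖ * ‖w‖) ^ 2 := sq_le_sq' (neg_le_of_abs_le (abs_real_inner_le_norm n w))
        (real_inner_le_norm n w)
      _ = s * (‖n‖ ^ 2 * ‖u‖ ^ 2) := by rw [mul_pow, hww]; ring

variable {F : ℂ → E3} {x : ℂ}

theorem contDiffAt_coord {n : WithTop ℕ∞} (hF : ContDiffAt ℝ n F x) (i : Fin 3) :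
    ContDiffAt ℝ n (fun ζ => F ζ i) x :=
  (EuclideanSpace.proj (𝕜 := ℝ) i).contDiff.contDiffAt.comp x hF

theorem fderiv_coord (hF : DifferentiableAt ℝ F x) (i : Fin 3) (v : ℂ) :
    fderiv ℝ (fun ζ => F ζ i) x v = fderiv ℝ F x v i :=
  DFunLike.congr_fun ((EuclideanSpace.proj (𝕜 := ℝ) i).hasFDerivAt.comp x hF.hasFDerivAt).fderiv v

theorem laplacian_coord (hF : ContDiffAt ℝ 2 F x) (i : Fin 3) :
    Δ (fun ζ => F ζ i) x = Δ F x i :=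
  hF.laplacian_CLM_comp_left (l := EuclideanSpace.proj (𝕜 := ℝ) i)

theorem sq_norm_fderiv_coord (hF : DifferentiableAt ℝ F x) (i : Fin 3) :
    ‖fderiv ℝ (fun ζ => F ζ i) x‖ ^ 2 = du F x i ^ 2 + dv F x i ^ 2 := by
  rw [sq_norm_eq_add_sq, fderiv_coord hF, fderiv_coord hF, du, dv]

/-- The function `log r - t²` on Euclidean three-space, where `t` is the second coordinate relative
to `t₀` and `r` the distance to the line `{x₁ = 0, x₃ = h}`. Along minimal surfaces it is strictly
superharmonic where `r ≥ 1` and `t` has no critical point. -/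
def slabBarrier (h t₀ : ℝ) (x : E3) : ℝ :=
  1 / 2 * Real.log (x 0 ^ 2 + (x 2 - h) ^ 2) - (x 1 - t₀) ^ 2

theorem laplacian_sub_const {E : Type*} [NormedAddCommGroup E] [InnerProductSpace ℝ E]
    [FiniteDimensional ℝ E] {f : E → ℝ} {x : E} (hf : ContDiffAt ℝ 2 f x) (c : ℝ) :
    Δ (fun y => f y - c) x = Δ f x := by
  have h := hf.laplacian_sub (contDiffAt_const (c := c))
  rw [laplacian_const, Pi.zero_apply, sub_zero] at h
  exact h

theorem laplacian_half_log_le (hF : ContDiffAt ℝ 2 F x) (hlap : Δ F x = 0)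
    (hw : IsWeaklyConformalAt F x) (h : ℝ) (hr : F x 0 ^ 2 + (F x 2 - h) ^ 2 ≠ 0) :
    Δ (fun ζ => 1 / 2 * Real.log (F ζ 0 ^ 2 + (F ζ 2 - h) ^ 2)) x ≤
      ‖fderiv ℝ (fun ζ => F ζ 1) x‖ ^ 2 / (F x 0 ^ 2 + (F x 2 - h) ^ 2) := by
  have hdiff : DifferentiableAt ℝ F x := hF.differentiableAt two_ne_zero
  have hΔ (i : Fin 3) : Δ (fun ζ => F ζ i) x = 0 := by
    rw [laplacian_coord hF, hlap, PiLp.zero_apply]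
  have hΔc : Δ (fun ζ => F ζ 2 - h) x = 0 := by
    rw [laplacian_sub_const (contDiffAt_coord hF 2), hΔ]
  have hnorm : ‖du F x‖ = ‖dv F x‖ := by rw [norm_eq_sqrt_real_inner, norm_eq_sqrt_real_inner, hw.1]
  have hnumerator : (‖fderiv ℝ (fun ζ => F ζ 0) x‖ ^ 2 + ‖fderiv ℝ (fun ζ => F ζ 2) x‖ ^ 2) *
      (F x 0 ^ 2 + (F x 2 - h) ^ 2) - 2 * ‖F x 0 • fderiv ℝ (fun ζ => F ζ 0) x +
        (F x 2 - h) • fderiv ℝ (fun ζ => F ζ 2) x‖ ^ 2 ≤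
      ‖fderiv ℝ (fun ζ => F ζ 1) x‖ ^ 2 * (F x 0 ^ 2 + (F x 2 - h) ^ 2) := by
    have hbessel := sq_inner_add_sq_inner_le hnorm hw.2 !₂[F x 2 - h, 0, -F x 0]
    have hE := congrArg ((F x 0 ^ 2 + (F x 2 - h) ^ 2) * ·) hw.1
    simp only [← real_inner_self_eq_norm_sq, inner_eq_sum, Matrix.cons_val] at hbessel hE
    simp only [sq_norm_fderiv_coord hdiff, sq_norm_eq_add_sq, add_apply,
      smul_apply, fderiv_coord hdiff, smul_eq_mul]
    simp only [du, dv] at *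
    linarith
  rw [laplacian_half_log_add_sq (contDiffAt_coord hF 0)
    ((contDiffAt_coord hF 2).sub contDiffAt_const) (hΔ 0) hΔc hr, fderiv_sub_const]
  refine (div_le_div_of_nonneg_right hnumerator (by positivity)).trans_eq ?_
  field_simp

theorem contDiffAt_half_log {n : WithTop ℕ∞} (hF : ContDiffAt ℝ n F x) {h : ℝ}
    (hr : F x 0 ^ 2 + (F x 2 - h) ^ 2 ≠ 0) :
    ContDiffAt ℝ n (fun ζ => 1 / 2 * Real.log (F ζ 0 ^ 2 + (F ζ 2 - h) ^ 2)) x :=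
  contDiffAt_const.mul ((((contDiffAt_coord hF 0).pow 2).add
    (((contDiffAt_coord hF 2).sub contDiffAt_const).pow 2)).log hr)

theorem contDiffAt_slabBarrier_comp {n : WithTop ℕ∞} (hF : ContDiffAt ℝ n F x) {h : ℝ} (t₀ : ℝ)
    (hr : F x 0 ^ 2 + (F x 2 - h) ^ 2 ≠ 0) : ContDiffAt ℝ n (slabBarrier h t₀ ∘ F) x :=
  (contDiffAt_half_log hF hr).sub (((contDiffAt_coord hF 1).sub contDiffAt_const).pow 2)

theorem laplacian_slabBarrier_comp_neg (hF : ContDiffAt ℝ 2 F x) (hlap : Δ F x = 0)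
    (hw : IsWeaklyConformalAt F x) {h : ℝ} (t₀ : ℝ) (hr : 1 ≤ F x 0 ^ 2 + (F x 2 - h) ^ 2)
    (ht : fderiv ℝ (fun ζ => F ζ 1) x ≠ 0) : Δ (slabBarrier h t₀ ∘ F) x < 0 := by
  have hr0 : F x 0 ^ 2 + (F x 2 - h) ^ 2 ≠ 0 := by positivity
  have hΔsq : Δ (fun ζ => (F ζ 1 - t₀) ^ 2) x = 2 * ‖fderiv ℝ (fun ζ => F ζ 1) x‖ ^ 2 := by
    rw [laplacian_sq ((contDiffAt_coord hF 1).sub contDiffAt_const), fderiv_sub_const,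
      laplacian_sub_const (contDiffAt_coord hF 1), laplacian_coord hF, hlap, PiLp.zero_apply,
      mul_zero, add_zero]
  have hnorm : 0 < ‖fderiv ℝ (fun ζ => F ζ 1) x‖ ^ 2 := by positivity
  have hsub := (contDiffAt_half_log hF hr0).laplacian_sub
    (((contDiffAt_coord hF 1).sub (contDiffAt_const (c := t₀))).pow 2)
  calc Δ (slabBarrier h t₀ ∘ F) x = _ := hsub.trans (congrArg _ hΔsq)
    _ ≤ ‖fderiv ℝ (fun ζ => F ζ 1) x‖ ^ 2 / (F x 0 ^ 2 + (F x 2 - h) ^ 2) -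
        2 * ‖fderiv ℝ (fun ζ => F ζ 1) x‖ ^ 2 :=
      sub_le_sub_right (laplacian_half_log_le hF hlap hw h hr0) _
    _ ≤ ‖fderiv ℝ (fun ζ => F ζ 1) x‖ ^ 2 - 2 * ‖fderiv ℝ (fun ζ => F ζ 1) x‖ ^ 2 :=
      sub_le_sub_right (div_le_self hnorm.le hr) _
    _ < 0 := by linarith

end SlabBarrier

section SlitBarrier

theorem harmonicAt_comp_of_analyticAt {V : ℂ → ℝ} {Φ : ℂ → ℂ} {x : ℂ} (hV : HarmonicAt V (Φ x))
    (hΦ : AnalyticAt ℂ Φ x) : HarmonicAt (fun ζ => V (Φ ζ)) x := by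
  obtain ⟨F, hF, hre⟩ := exists_analyticAt_re_eventuallyEq hV
  have hcongr : (fun ζ => (F (Φ ζ)).re) =ᶠ[𝓝 x] fun ζ => V (Φ ζ) := hΦ.continuousAt.eventually hre
  exact (harmonicAt_congr_nhds hcongr).1
    (AnalyticAt.harmonicAt_re (f := fun ζ => F (Φ ζ)) (hF.comp hΦ))

/-- The Green function of the right half-plane with pole `e > 0`. At the pole the convention
`x / 0 = 0` gives it the value `0`. -/
def halfPlaneGreen (e : ℝ) (ξ : ℂ) : ℝ := Real.log ‖(ξ + e) / (ξ - e)‖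

theorem sq_norm_add_ofReal (ξ : ℂ) (e : ℝ) : ‖ξ + e‖ ^ 2 = ‖ξ - e‖ ^ 2 + 4 * e * ξ.re := by
  simp only [← Complex.normSq_eq_norm_sq, Complex.normSq_apply, Complex.add_re, Complex.sub_re,
    Complex.add_im, Complex.sub_im, Complex.ofReal_re, Complex.ofReal_im]
  ring

theorem halfPlaneGreen_nonneg {e : ℝ} (he : 0 ≤ e) {ξ : ℂ} (hξ : 0 ≤ ξ.re) :
    0 ≤ halfPlaneGreen e ξ := by
  rw [halfPlaneGreen, norm_div]
  rcases (norm_nonneg (ξ - e)).eq_or_lt with h | h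
  · rw [← h, div_zero, Real.log_zero]
  · refine Real.log_nonneg ((one_le_div h).2 (abs_le_of_sq_le_sq' ?_ (norm_nonneg _)).2)
    rw [sq_norm_add_ofReal]
    linarith [mul_nonneg he hξ]

theorem halfPlaneGreen_eq_zero_of_re_eq_zero (e : ℝ) {ξ : ℂ} (hξ : ξ.re = 0) :
    halfPlaneGreen e ξ = 0 := by
  have h : ‖ξ + e‖ = ‖ξ - e‖ := by
    rw [← sq_eq_sq₀ (norm_nonneg _) (norm_nonneg _), sq_norm_add_ofReal, hξ, mul_zero, add_zero]
  rw [halfPlaneGreen, norm_div, h]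
  rcases eq_or_ne ‖ξ - e‖ 0 with h0 | h0
  · rw [h0, div_zero, Real.log_zero]
  · rw [div_self h0, Real.log_one]

theorem harmonicAt_halfPlaneGreen {e : ℝ} (he : 0 < e) {ξ : ℂ} (hξ : 0 ≤ ξ.re) (hne : ξ ≠ e) :
    HarmonicAt (halfPlaneGreen e) ξ := by
  have hadd : ξ + e ≠ 0 := fun h => by
    have := congrArg Complex.re h
    simp only [Complex.add_re, Complex.ofReal_re, Complex.zero_re] at this
    linarith
  exact AnalyticAt.harmonicAt_log_norm ((analyticAt_id.add analyticAt_const).div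
    (analyticAt_id.sub analyticAt_const) (sub_ne_zero.2 hne)) (div_ne_zero hadd (sub_ne_zero.2 hne))

theorem exists_forall_lt_halfPlaneGreen {b : ℝ} (hb : 0 < b) (Λ : ℝ) :
    ∃ c < b, ∀ s ∈ Ioo c b, Λ < halfPlaneGreen b s := by
  refine ⟨max 0 (b - b * Real.exp (-Λ)), max_lt hb (by linarith [mul_pos hb (Real.exp_pos (-Λ))]),
    fun s ⟨hs, hsb⟩ => ?_⟩
  obtain ⟨hs0, hs⟩ := max_lt_iff.1 hs
  have hbs : 0 < b - s := sub_pos.2 hsb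
  have hquot : Real.exp Λ < (s + b) / (b - s) := by
    rw [lt_div_iff₀ hbs]
    calc Real.exp Λ * (b - s) < Real.exp Λ * (b * Real.exp (-Λ)) := by gcongr; linarith
      _ = b := by rw [mul_left_comm, ← Real.exp_add, add_neg_cancel, Real.exp_zero, mul_one]
      _ < s + b := by linarith
  have hnorm : ‖((s : ℂ) + b) / (s - b)‖ = (s + b) / (b - s) := by
    rw [← Complex.ofReal_add, ← Complex.ofReal_sub, norm_div, Complex.norm_real, Complex.norm_real,
      Real.norm_of_nonneg (by linarith), Real.norm_of_nonpos (by linarith), neg_sub]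
  rwa [halfPlaneGreen, hnorm, Real.lt_log_iff_exp_lt ((Real.exp_pos Λ).trans hquot)]

/-- The segment `[-r, r]` of the real axis in the complex plane. -/
def slit (r : ℝ) : Set ℂ := Complex.ofReal '' Icc (-r) r

theorem ofReal_mem_slit {r x : ℝ} : (x : ℂ) ∈ slit r ↔ x ∈ Icc (-r) r :=
  Complex.ofReal_injective.mem_set_image

theorem neg_mem_slit {r : ℝ} {w : ℂ} (hw : w ∈ slit r) : -w ∈ slit r := by
  obtain ⟨x, hx, rfl⟩ := hw
  exact ⟨-x, ⟨neg_le_neg hx.2, neg_le.1 hx.1⟩, Complex.ofReal_neg x⟩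

/-- A branch of `√((w - r) / (w + r))`, which maps the complement of the slit `[-r, r]` conformally
into the right half-plane. -/
def slitSqrt (r : ℝ) (w : ℂ) : ℂ := ((w - r) / (w + r)) ^ (2⁻¹ : ℂ)

theorem slitSqrt_sq (r : ℝ) (w : ℂ) : slitSqrt r w ^ 2 = (w - r) / (w + r) := by
  simp [slitSqrt]

theorem slitSqrt_re_nonneg (r : ℝ) (w : ℂ) : 0 ≤ (slitSqrt r w).re := by
  rw [slitSqrt]
  generalize (w - r) / (w + r) = v
  rcases eq_or_ne v 0 with rfl | hv
  · simp
  · have him : (Complex.log v * 2⁻¹).im = v.arg / 2 := by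
      rw [← div_eq_mul_inv, Complex.div_ofNat_im, Complex.log_im]
    rw [Complex.cpow_def_of_ne_zero hv, Complex.exp_re, him]
    exact mul_nonneg (Real.exp_pos _).le (Real.cos_nonneg_of_mem_Icc
      ⟨by linarith [Complex.neg_pi_lt_arg v], by linarith [Complex.arg_le_pi v]⟩)

theorem slitSqrt_ofReal {r x : ℝ} (hx : 0 ≤ (x - r) / (x + r)) :
    slitSqrt r x = (√((x - r) / (x + r)) : ℝ) := by
  rw [slitSqrt, Real.sqrt_eq_rpow, Complex.ofReal_cpow hx]
  norm_num

theorem slitSqrt_re_eq_zero {r : ℝ} {w : ℂ} (hw : w ∈ slit r) : (slitSqrt r w).re = 0 := by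
  obtain ⟨x, hx, rfl⟩ := hw
  have hquot : (x - r) / (x + r) ≤ 0 :=
    div_nonpos_of_nonpos_of_nonneg (by linarith [hx.2]) (by linarith [hx.1])
  have hsq := slitSqrt_sq r x
  rw [← Complex.ofReal_sub, ← Complex.ofReal_add, ← Complex.ofReal_div, sq, Complex.ext_iff,
    Complex.mul_re, Complex.mul_im, Complex.ofReal_re, Complex.ofReal_im] at hsq
  obtain ⟨hre, him⟩ := hsq
  rcases mul_eq_zero.1 (by linarith : (slitSqrt r x).re * (slitSqrt r x).im = 0) with h | h
  · exact h
  · rw [h] at hre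
    nlinarith

theorem add_ne_zero_of_notMem_slit {r : ℝ} (hr : 0 < r) {w : ℂ} (hw : w ∉ slit r) : w + r ≠ 0 :=
  fun h => hw ⟨-r, ⟨le_rfl, by linarith⟩, by
    rw [Complex.ofReal_neg]; exact (eq_neg_of_add_eq_zero_left h).symm⟩

theorem div_mem_slitPlane_of_notMem_slit {r : ℝ} (hr : 0 < r) {w : ℂ} (hw : w ∉ slit r) :
    (w - r) / (w + r) ∈ Complex.slitPlane := by
  by_contra hn
  rw [Complex.mem_slitPlane_iff_not_le_zero, not_not] at hn
  obtain ⟨c, hc0, hc⟩ : ∃ c : ℝ, 0 ≤ c ∧ (w - r) / (w + r) = ((-c : ℝ) : ℂ) :=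
    ⟨-((w - r) / (w + r)).re, by simpa using (Complex.le_def.1 hn).1,
      Complex.ext (by simp) (by simpa using (Complex.le_def.1 hn).2)⟩
  rw [div_eq_iff (add_ne_zero_of_notMem_slit hr hw)] at hc
  have hc1 : (1 + c : ℂ) ≠ 0 := by exact_mod_cast (by linarith : (1 + c : ℝ) ≠ 0)
  refine hw ⟨r * (1 - c) / (1 + c), ⟨?_, ?_⟩, ?_⟩
  · rw [le_div_iff₀ (by linarith)]; nlinarith
  · rw [div_le_iff₀ (by linarith)]; nlinarith
  · push_cast at hc ⊢
    rw [div_eq_iff hc1]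
    linear_combination -hc

theorem analyticAt_slitSqrt {r : ℝ} (hr : 0 < r) {w : ℂ} (hw : w ∉ slit r) :
    AnalyticAt ℂ (slitSqrt r) w :=
  ((analyticAt_id.sub analyticAt_const).div (analyticAt_id.add analyticAt_const)
    (add_ne_zero_of_notMem_slit hr hw)).cpow analyticAt_const
    (div_mem_slitPlane_of_notMem_slit hr hw)

theorem exists_lt_of_slitSqrt_eq {r : ℝ} (hr : 0 < r) {w : ℂ} (hw : w ∉ slit r) {b : ℝ}
    (hb : b ∈ Ioc 0 1) (h : slitSqrt r w = b) : ∃ x : ℝ, r < x ∧ w = x := by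
  have hsq := slitSqrt_sq r w
  rw [h, eq_div_iff (add_ne_zero_of_notMem_slit hr hw)] at hsq
  have hb1 : 0 < 1 - b ^ 2 := by
    rcases hb.2.eq_or_lt with rfl | hlt
    · have hre := congrArg Complex.re hsq
      simp only [Complex.ofReal_one, one_pow, one_mul, Complex.add_re, Complex.sub_re,
        Complex.ofReal_re] at hre
      linarith
    · nlinarith [hb.1]
  refine ⟨r * (1 + b ^ 2) / (1 - b ^ 2), ?_, ?_⟩
  · rw [lt_div_iff₀ hb1]
    nlinarith [mul_pos hr (pow_pos hb.1 2)]
  · have hne : (1 - b ^ 2 : ℂ) ≠ 0 := by exact_mod_cast hb1.ne'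
    push_cast
    rw [eq_div_iff hne]
    linear_combination -hsq

/-- The Green function of the complement of the slit `[-r, r]` whose pole is the point that
`slitSqrt r` maps to `b`: a point of `(r, ∞)` if `b < 1`, the point at infinity if `b = 1`. -/
def slitGreen (r b : ℝ) (w : ℂ) : ℝ := halfPlaneGreen b (slitSqrt r w)

theorem slitGreen_nonneg (r : ℝ) {b : ℝ} (hb : 0 ≤ b) (w : ℂ) : 0 ≤ slitGreen r b w :=
  halfPlaneGreen_nonneg hb (slitSqrt_re_nonneg r w)

theorem slitGreen_eq_zero {r : ℝ} (b : ℝ) {w : ℂ} (hw : w ∈ slit r) : slitGreen r b w = 0 :=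
  halfPlaneGreen_eq_zero_of_re_eq_zero b (slitSqrt_re_eq_zero hw)

theorem strictMonoOn_sqrt_div {r : ℝ} (hr : 0 < r) :
    StrictMonoOn (fun x => √((x - r) / (x + r))) (Ioi r) := by
  intro x (hx : r < x) y _ hxy
  refine Real.sqrt_lt_sqrt (div_nonneg (by linarith) (by linarith)) ?_
  rw [div_lt_div_iff₀ (by linarith) (by linarith)]
  nlinarith

theorem exists_forall_lt_of_strictMonoOn {r : ℝ} {I : Set ℝ} (hI : IsOpen I)
    (hIr : (I ∩ Ioi r).Nonempty) {χ : ℝ → ℝ} (hχ : StrictMonoOn χ (Ioi r))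
    (hbdd : BddAbove (χ '' (I ∩ Ioi r))) :
    (∀ x ∈ I, r < x → χ x < sSup (χ '' (I ∩ Ioi r))) ∧
      ∀ c < sSup (χ '' (I ∩ Ioi r)), ∃ x₁ ∈ I, r < x₁ ∧ ∀ x ∈ I, x₁ < x → c < χ x := by
  refine ⟨fun x hx hrx => ?_, fun c hc => ?_⟩
  · obtain ⟨y, hyI, hxy⟩ : ∃ y ∈ I, x < y :=
      (((hI.eventually_mem hx).filter_mono nhdsWithin_le_nhds).and
        (eventually_mem_nhdsWithin (s := Ioi x))).exists
    exact (hχ hrx (hrx.trans hxy) hxy).trans_le (le_csSup hbdd ⟨y, ⟨hyI, hrx.trans hxy⟩, rfl⟩)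
  · obtain ⟨_, ⟨x₁, ⟨hx₁, hr₁⟩, rfl⟩, hc₁⟩ := exists_lt_of_lt_csSup (hIr.image χ) hc
    exact ⟨x₁, hx₁, hr₁, fun x _ hx => hc₁.trans (hχ hr₁ (hr₁.trans hx) hx)⟩

theorem exists_slitGreen {r : ℝ} (hr : 0 < r) {I : Set ℝ} (hI : IsOpen I)
    (hIr : (I ∩ Ioi r).Nonempty) : ∃ b : ℝ, 0 < b ∧
      (∀ w ∉ slit r, (w.im = 0 → w.re ∈ I) → HarmonicAt (slitGreen r b) w) ∧
      ∀ Λ : ℝ, ∃ x₁ ∈ I, r < x₁ ∧ ∀ x ∈ I, slitGreen r b x ≤ Λ → x ≤ x₁ := by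
  set χ : ℝ → ℝ := fun x => √((x - r) / (x + r))
  have hquot (x : ℝ) (hx : r < x) : 0 < (x - r) / (x + r) := div_pos (by linarith) (by linarith)
  have hχ1 : ∀ y ∈ χ '' (I ∩ Ioi r), y ≤ 1 := by
    rintro _ ⟨x, ⟨-, hx : r < x⟩, rfl⟩
    exact Real.sqrt_le_one.2 ((div_le_one (by linarith)).2 (by linarith))
  have hχr (x : ℝ) (hx : r < x) : slitSqrt r x = χ x := slitSqrt_ofReal (hquot x hx).le
  set b := sSup (χ '' (I ∩ Ioi r))
  obtain ⟨hlt, hsup⟩ : (∀ x ∈ I, r < x → χ x < b) ∧ _ :=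
    exists_forall_lt_of_strictMonoOn hI hIr (strictMonoOn_sqrt_div hr) ⟨1, hχ1⟩
  have hb : 0 < b := by
    obtain ⟨x, hx, hrx⟩ := hIr
    exact (Real.sqrt_pos.2 (hquot x hrx)).trans (hlt x hx hrx)
  refine ⟨b, hb, fun w hw hwI => ?_, fun Λ => ?_⟩
  · refine harmonicAt_comp_of_analyticAt (V := halfPlaneGreen b)
      (harmonicAt_halfPlaneGreen hb (slitSqrt_re_nonneg r w) fun hpole => ?_)
      (analyticAt_slitSqrt hr hw)
    obtain ⟨x, hrx, rfl⟩ :=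
      exists_lt_of_slitSqrt_eq hr hw ⟨hb, csSup_le (hIr.image χ) hχ1⟩ hpole
    rw [hχr x hrx, Complex.ofReal_inj] at hpole
    exact (hlt x (hwI (Complex.ofReal_im x)) hrx).ne hpole
  · obtain ⟨c, hcb, hc⟩ := exists_forall_lt_halfPlaneGreen hb Λ
    obtain ⟨x₁, hx₁, hr₁, hlt₁⟩ := hsup c hcb
    refine ⟨x₁, hx₁, hr₁, fun x hx hΛ => not_lt.1 fun hx₁x => hΛ.not_gt ?_⟩
    have hrx := hr₁.trans hx₁x
    rw [slitGreen, hχr x hrx]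
    exact hc _ ⟨hlt₁ x hx hx₁x, hlt x hx hrx⟩

/-- A nonnegative function on the plane that vanishes on the slit `[-r, r]`, is harmonic off the
slit except possibly at real points outside `I`, and is large near both ends of the set `I` on the
real axis. -/
structure IsSlitBarrier (r : ℝ) (I : Set ℝ) (V : ℂ → ℝ) : Prop where
  nonneg : ∀ w, 0 ≤ V w
  eq_zero : ∀ w ∈ slit r, V w = 0
  harmonicAt : ∀ w ∉ slit r, (w.im = 0 → w.re ∈ I) → HarmonicAt V w
  exists_Icc : ∀ Λ : ℝ, ∃ x₀ ∈ I, ∃ x₁ ∈ I, ∀ x ∈ I, V x ≤ Λ → x ∈ Icc x₀ x₁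

theorem exists_isSlitBarrier {r : ℝ} (hr : 0 < r) {I : Set ℝ} (hI : IsOpen I)
    (hIr : (I ∩ Ioi r).Nonempty) (hIl : (I ∩ Iio (-r)).Nonempty) : ∃ V, IsSlitBarrier r I V := by
  obtain ⟨b, hb, hbharm, hbI⟩ := exists_slitGreen hr hI hIr
  obtain ⟨a, ha, haharm, haI⟩ := exists_slitGreen (I := -I) hr hI.neg <| by
    obtain ⟨x, hx, hxr⟩ := hIl
    exact ⟨-x, by simpa using hx, lt_neg.1 (mem_Iio.1 hxr)⟩
  refine ⟨fun w => slitGreen r b w + slitGreen r a (-w), fun w => add_nonneg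
    (slitGreen_nonneg r hb.le w) (slitGreen_nonneg r ha.le _), fun w hw => ?_, fun w hw hwI => ?_,
    fun Λ => ?_⟩
  · rw [slitGreen_eq_zero b hw, slitGreen_eq_zero a (neg_mem_slit hw), add_zero]
  · exact (hbharm w hw hwI).add (harmonicAt_comp_of_analyticAt
      (haharm (-w) (fun h => hw (neg_neg w ▸ neg_mem_slit h)) fun him => by
        simpa using hwI (by simpa using him)) analyticAt_id.neg)
  · obtain ⟨x₁, hx₁, -, hle⟩ := hbI Λ
    obtain ⟨x₀, hx₀, -, hge⟩ := haI Λ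
    refine ⟨-x₀, hx₀, x₁, hx₁, fun x hx hΛ => ⟨neg_le.1 (hge (-x) (by simpa using hx) ?_),
      hle x hx ?_⟩⟩
    · rw [Complex.ofReal_neg]
      linarith [slitGreen_nonneg r hb.le x]
    · linarith [slitGreen_nonneg r ha.le (-x)]

end SlitBarrier

section Charts

variable {R : Type*} [TopologicalSpace R] {M B : Set R}

theorem IsSurfaceWithBoundary.diff_eq_interior_diff (hM : IsSurfaceWithBoundary M B) :
    M \ B = interior M \ B :=
  Subset.antisymm
    (fun _ h => ⟨not_not.1 fun hn => h.2 (hM.frontier_subset ⟨subset_closure h.1, hn⟩), h.2⟩)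
    (sdiff_le_sdiff_right interior_subset)

theorem IsSurfaceWithBoundary.isOpen_diff (hM : IsSurfaceWithBoundary M B) : IsOpen (M \ B) :=
  hM.diff_eq_interior_diff ▸ isOpen_interior.sdiff hM.isClosed_boundary

theorem IsSurfaceWithBoundary.eventually_nhdsNE_mem_diff (hM : IsSurfaceWithBoundary M B) {p : R}
    (hp : p ∈ interior M) : ∀ᶠ q in 𝓝[≠] p, q ∈ M \ B := by
  by_cases hpB : p ∈ B
  · obtain ⟨U, hU, hUB⟩ := hM.isolated p ⟨hpB, fun h => h.2 hp⟩
    filter_upwards [nhdsWithin_le_nhds hU, nhdsWithin_le_nhds (isOpen_interior.mem_nhds hp),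
      self_mem_nhdsWithin] with q hqU hqM hq
    exact ⟨interior_subset hqM, fun hqB => hq (hUB.subset ⟨hqU, hqB⟩)⟩
  · exact nhdsWithin_le_nhds (hM.isOpen_diff.mem_nhds ⟨interior_subset hp, hpB⟩)

theorem tendsto_symm_nhdsNE {S : Type*} [TopologicalSpace S] {e : OpenPartialHomeomorph R S}
    {x : S} (hx : x ∈ e.target) : Tendsto e.symm (𝓝[≠] x) (𝓝[≠] (e.symm x)) := by
  refine tendsto_nhdsWithin_iff.2
    ⟨(e.continuousAt_symm hx).tendsto.mono_left nhdsWithin_le_nhds, ?_⟩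
  filter_upwards [self_mem_nhdsWithin, nhdsWithin_le_nhds (e.open_target.mem_nhds hx)]
    with y hy hyt h
  exact hy (e.symm.injOn hyt hx h)

theorem eventually_mem_target_and_symm_mem_interior {S : Type*} [TopologicalSpace S]
    {e : OpenPartialHomeomorph R S} {x : S} (hx : x ∈ e.target) (hxM : e.symm x ∈ interior M) :
    ∀ᶠ y in 𝓝 x, y ∈ e.target ∧ e.symm y ∈ interior M :=
  (e.open_target.eventually_mem hx).and
    ((e.continuousAt_symm hx).eventually_mem (isOpen_interior.mem_nhds hxM))

variable [ChartedSpace ℂ R]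

/-- A complex function on a Riemann surface is holomorphic at `p`: in every holomorphic chart of
the atlas around `p` it is holomorphic near the image of `p`. -/
def IsHolomorphicAt (F : R → ℂ) (p : R) : Prop :=
  ∀ e ∈ atlas ℂ R, p ∈ e.source → AnalyticAt ℂ (F ∘ e.symm) (e p)

theorem IsHolomorphicAt.isHarmonicAt_comp {F : R → ℂ} {p : R} (hF : IsHolomorphicAt F p)
    {V : ℂ → ℝ} (hV : HarmonicAt V (F p)) : IsHarmonicAt (fun q => V (F q)) p :=
  fun e he hp => harmonicAt_comp_of_analyticAt (V := V) (Φ := F ∘ e.symm)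
    (by rwa [Function.comp_apply, e.left_inv hp]) (hF e he hp)

theorem IsHolomorphicAt.congr {F G : R → ℂ} {p : R} (hF : IsHolomorphicAt F p)
    (h : F =ᶠ[𝓝 p] G) : IsHolomorphicAt G p :=
  fun e he hp => (hF e he hp).congr ((e.tendsto_symm hp).eventually h)

theorem eventually_sub_eq_of_eventually_im_eq {F G : ℂ → ℂ} {x : ℂ} (hF : AnalyticAt ℂ F x)
    (hG : AnalyticAt ℂ G x) (him : ∀ᶠ ζ in 𝓝 x, (F ζ).im = (G ζ).im) :
    ∀ᶠ ζ in 𝓝 x, F ζ - G ζ = F x - G x := by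
  obtain ⟨r, hr, hball⟩ :=
    Metric.eventually_nhds_iff_ball.1 ((hF.sub hG).eventually_analyticAt.and him)
  obtain ⟨c, hc⟩ := AnalyticOnNhd.eq_const_of_im_eq_const (f := F - G) (c₀ := 0)
    (fun ζ hζ => (hball ζ hζ).1)
    (fun ζ hζ => by rw [Pi.sub_apply, Complex.sub_im, (hball ζ hζ).2, sub_self])
    Metric.isOpen_ball (Metric.isConnected_ball hr)
  filter_upwards [Metric.ball_mem_nhds x hr] with ζ hζ
  exact (hc ζ hζ).trans (hc x (Metric.mem_ball_self hr)).symm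

theorem IsHolomorphicAt.eventually_sub_eq {F G : R → ℂ} {p : R} (hF : IsHolomorphicAt F p)
    (hG : IsHolomorphicAt G p) (him : ∀ᶠ q in 𝓝 p, (F q).im = (G q).im) :
    ∀ᶠ q in 𝓝 p, F q - G q = F p - G p := by
  have he := chart_mem_atlas ℂ p
  have hp := mem_chart_source ℂ p
  have hconst := eventually_sub_eq_of_eventually_im_eq (hF _ he hp) (hG _ he hp)
    (((chartAt ℂ p).tendsto_symm hp).eventually him)
  filter_upwards [((chartAt ℂ p).continuousAt hp).eventually hconst,
    (chartAt ℂ p).open_source.mem_nhds hp] with q hq hqs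
  simpa only [Function.comp_apply, (chartAt ℂ p).left_inv hqs, (chartAt ℂ p).left_inv hp] using hq

variable [IsManifold 𝓘(ℂ) ω R] {e e' : OpenPartialHomeomorph R ℂ}

theorem contDiffOn_transition (he : e ∈ atlas ℂ R) (he' : e' ∈ atlas ℂ R) :
    ContDiffOn ℂ ω (e' ∘ e.symm) (e.symm.trans e').source := by
  simpa [contDiffPregroupoid] using (mem_groupoid_of_pregroupoid.1
    (HasGroupoid.compatible (G := contDiffGroupoid ω 𝓘(ℂ)) he he')).1

theorem analyticAt_transition (he : e ∈ atlas ℂ R) (he' : e' ∈ atlas ℂ R) {p : R}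
    (hp : p ∈ e.source) (hp' : p ∈ e'.source) : AnalyticAt ℂ (e' ∘ e.symm) (e p) :=
  ((contDiffOn_transition he he').contDiffAt ((e.symm.trans e').open_source.mem_nhds
    (by simp [hp, hp']))).analyticAt

theorem isHolomorphicAt_comp_chart (he' : e' ∈ atlas ℂ R) {p : R} (hp' : p ∈ e'.source)
    {K : ℂ → ℂ} (hK : AnalyticAt ℂ K (e' p)) : IsHolomorphicAt (fun q => K (e' q)) p := by
  intro e he hp
  refine AnalyticAt.fun_comp (f := e' ∘ e.symm) ?_ (analyticAt_transition he he' hp hp')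
  rwa [Function.comp_apply, e.left_inv hp]

theorem IsHolomorphicAt.eventually {F : R → ℂ} {p : R} (hF : IsHolomorphicAt F p) :
    ∀ᶠ q in 𝓝 p, IsHolomorphicAt F q := by
  have he := chart_mem_atlas ℂ p
  have hp := mem_chart_source ℂ p
  filter_upwards [(chartAt ℂ p).open_source.mem_nhds hp,
    ((chartAt ℂ p).continuousAt hp).eventually (hF _ he hp).eventually_analyticAt] with q hqs hq
  refine (isHolomorphicAt_comp_chart he hqs hq).congr ?_
  filter_upwards [(chartAt ℂ p).open_source.mem_nhds hqs] with q' hq'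
  exact congrArg F ((chartAt ℂ p).left_inv hq')

instance isManifold_real : IsManifold 𝓘(ℝ, ℂ) ∞ R :=
  isManifold_of_contDiffOn 𝓘(ℝ, ℂ) ∞ R fun e e' he he' => by
    simpa using ((contDiffOn_transition he he').restrict_scalars ℝ).of_le le_top

theorem contDiffAt_comp_symm {G : Type*} [NormedAddCommGroup G] [NormedSpace ℝ G] {Y : R → G}
    (hY : ContMDiff 𝓘(ℝ, ℂ) 𝓘(ℝ, G) ∞ Y) (he : e ∈ atlas ℂ R) {x : ℂ} (hx : x ∈ e.target) :
    ContDiffAt ℝ ∞ (Y ∘ e.symm) x :=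
  (hY.comp_contMDiffOn (contMDiffOn_symm_of_mem_maximalAtlas
    (IsManifold.subset_maximalAtlas he))).contDiffOn.contDiffAt (e.open_target.mem_nhds hx)

end Charts

section Harmonic

theorem continuousAt_laplacian {G : Type*} [NormedAddCommGroup G] [NormedSpace ℝ G] {F : ℂ → G}
    {x : ℂ} (hF : ContDiffAt ℝ 2 F x) : ContinuousAt (Δ F) x := by
  have hsecond : ContinuousAt (fderiv ℝ (fderiv ℝ F)) x :=
    ((hF.fderiv_right (m := 1) le_rfl).fderiv_right (m := 0) le_rfl).continuousAt
  simp only [laplacian_eq_iteratedFDeriv_complexPlane, iteratedFDeriv_two_apply,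
    Matrix.cons_val_zero, Matrix.cons_val_one]
  fun_prop

theorem isWeaklyConformalAt_of_eventually_nhdsNE {F : ℂ → E3} {x : ℂ} (hF : ContDiffAt ℝ 1 F x)
    (h : ∀ᶠ ζ in 𝓝[≠] x, IsWeaklyConformalAt F ζ) : IsWeaklyConformalAt F x := by
  have hfderiv : ContinuousAt (fderiv ℝ F) x := (hF.fderiv_right (m := 0) le_rfl).continuousAt
  have hdu : ContinuousAt (du F) x := hfderiv.clm_apply continuousAt_const
  have hdv : ContinuousAt (dv F) x := hfderiv.clm_apply continuousAt_const
  exact ⟨(((hdu.inner hdu).eventuallyEq_nhds_iff_eventuallyEq_nhdsNE (hdv.inner hdv)).1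
      (h.mono fun _ hζ => hζ.1)).self_of_nhds,
    (((hdu.inner hdv).eventuallyEq_nhds_iff_eventuallyEq_nhdsNE continuousAt_const).1
      (h.mono fun _ hζ => hζ.2)).self_of_nhds⟩

namespace IsConformalMinimalImmersion

variable {R : Type*} [TopologicalSpace R] [ChartedSpace ℂ R] {Y : R → E3} {M B : Set R}
  {e : OpenPartialHomeomorph R ℂ} {x : ℂ}

theorem conformalAt_comp_symm (hY : IsConformalMinimalImmersion Y M B) (he : e ∈ atlas ℂ R)
    (hx : x ∈ e.target) (hxM : e.symm x ∈ M \ B) : ConformalAt (Y ∘ e.symm) x := by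
  simpa only [e.right_inv hx] using hY.conformal _ hxM e he (e.map_target hx)

variable [IsManifold 𝓘(ℂ) ω R]

theorem laplacian_comp_symm_eq_zero_of_mem_diff (hY : IsConformalMinimalImmersion Y M B)
    (hM : IsSurfaceWithBoundary M B) (he : e ∈ atlas ℂ R) (hx : x ∈ e.target)
    (hxM : e.symm x ∈ M \ B) : Δ (Y ∘ e.symm) x = 0 := by
  refine laplacian_eq_zero_of_meanCurvature_eq_zero
    ((contDiffAt_comp_symm hY.smooth he hx).of_le ENat.LEInfty.out) ?_ ?_
  · filter_upwards [e.open_target.mem_nhds hx,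
      (e.continuousAt_symm hx).eventually_mem (hM.isOpen_diff.mem_nhds hxM)] with y hy hyM
    exact hY.conformalAt_comp_symm he hy hyM
  · simpa only [e.right_inv hx] using hY.minimal _ hxM e he (e.map_target hx)

theorem isWeaklyConformalAt_comp_symm (hY : IsConformalMinimalImmersion Y M B)
    (hM : IsSurfaceWithBoundary M B) (he : e ∈ atlas ℂ R) (hx : x ∈ e.target)
    (hxM : e.symm x ∈ interior M) : IsWeaklyConformalAt (Y ∘ e.symm) x := by
  refine isWeaklyConformalAt_of_eventually_nhdsNE
    ((contDiffAt_comp_symm hY.smooth he hx).of_le ENat.LEInfty.out) ?_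
  filter_upwards [(tendsto_symm_nhdsNE hx).eventually (hM.eventually_nhdsNE_mem_diff hxM),
    nhdsWithin_le_nhds (e.open_target.mem_nhds hx)] with y hyM hy
  exact isWeaklyConformalAt_of_conformalAt (hY.conformalAt_comp_symm he hy hyM)

theorem laplacian_comp_symm_eq_zero (hY : IsConformalMinimalImmersion Y M B)
    (hM : IsSurfaceWithBoundary M B) (he : e ∈ atlas ℂ R) (hx : x ∈ e.target)
    (hxM : e.symm x ∈ interior M) : Δ (Y ∘ e.symm) x = 0 := by
  refine (((continuousAt_laplacian ((contDiffAt_comp_symm hY.smooth he hx).of_le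
    ENat.LEInfty.out)).eventuallyEq_nhds_iff_eventuallyEq_nhdsNE
    (g := fun _ => 0) continuousAt_const).1 ?_).self_of_nhds
  filter_upwards [(tendsto_symm_nhdsNE hx).eventually (hM.eventually_nhdsNE_mem_diff hxM),
    nhdsWithin_le_nhds (e.open_target.mem_nhds hx)] with y hyM hy
  exact hY.laplacian_comp_symm_eq_zero_of_mem_diff hM he hy hyM

theorem harmonicAt_comp_symm (hY : IsConformalMinimalImmersion Y M B)
    (hM : IsSurfaceWithBoundary M B) (he : e ∈ atlas ℂ R) (hx : x ∈ e.target)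
    (hxM : e.symm x ∈ interior M) : HarmonicAt (Y ∘ e.symm) x :=
  ⟨(contDiffAt_comp_symm hY.smooth he hx).of_le ENat.LEInfty.out,
    (eventually_mem_target_and_symm_mem_interior hx hxM).mono fun _ hy =>
      hY.laplacian_comp_symm_eq_zero hM he hy.1 hy.2⟩

end IsConformalMinimalImmersion

end Harmonic

section Projection

/-- The projection `proj` as a continuous linear map. -/
def projCLM : E3 →L[ℝ] ℂ :=
  Complex.equivRealProdCLM.symm ∘L (EuclideanSpace.proj 0).prod (EuclideanSpace.proj 1)

theorem coe_projCLM : ⇑projCLM = proj := rfl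

theorem exists_eventually_im_eq_im_proj {R : Type*} [TopologicalSpace R] [ChartedSpace ℂ R]
    [IsManifold 𝓘(ℂ) ω R] {Y : R → E3} {M B : Set R} (hY : IsConformalMinimalImmersion Y M B)
    (hM : IsSurfaceWithBoundary M B) {p : R} (hp : p ∈ interior M) :
    ∃ G : R → ℂ, IsHolomorphicAt G p ∧ ∀ᶠ q in 𝓝 p, (G q).im = (proj (Y q)).im := by
  have hps := mem_chart_source ℂ p
  obtain ⟨H, hH, hre⟩ := exists_analyticAt_re_eventuallyEq ((hY.harmonicAt_comp_symm hM
    (chart_mem_atlas ℂ p) ((chartAt ℂ p).map_source hps)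
    (by rwa [(chartAt ℂ p).left_inv hps])).comp_CLM (l := Complex.imCLM ∘L projCLM))
  refine ⟨fun q => Complex.I * H (chartAt ℂ p q), isHolomorphicAt_comp_chart
    (K := fun ζ => Complex.I * H ζ) (chart_mem_atlas ℂ p) hps (analyticAt_const.mul hH), ?_⟩
  filter_upwards [(chartAt ℂ p).open_source.mem_nhds hps,
    ((chartAt ℂ p).continuousAt hps).eventually hre] with q hqs hq
  rw [Complex.I_mul_im, hq]
  simp only [Function.comp_apply, ContinuousLinearMap.comp_apply, Complex.imCLM_apply,
    coe_projCLM, (chartAt ℂ p).left_inv hqs]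

end Projection

section GraphLift

/-- `φ` is the inverse of the bijection `proj ∘ Y` of `M` onto `Ω`. -/
structure IsGraphLift {R : Type*} [TopologicalSpace R] (Y : R → E3) (M : Set R) (Ω : Set ℂ)
    (φ : ℂ → R) : Prop where
  continuousOn : ContinuousOn φ Ω
  mapsTo : MapsTo φ Ω M
  proj_apply : ∀ w ∈ Ω, proj (Y (φ w)) = w
  proj_mem : ∀ p ∈ M, proj (Y p) ∈ Ω
  apply_proj : ∀ p ∈ M, φ (proj (Y p)) = p

variable {R : Type*} [TopologicalSpace R] {Y : R → E3} {M B : Set R} {Ω : Set ℂ} {φ : ℂ → R}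

theorem isClosedEmbedding_domRestrict (hproper : IsProperMap (M.domRestrict Y))
    (hinj : InjOn Y M) : Topology.IsClosedEmbedding (M.domRestrict Y) :=
  .of_continuous_injective_isClosedMap hproper.continuous (injOn_iff_injective.1 hinj)
    hproper.isClosedMap

theorem continuousOn_of_comp_eq {X : Type*} [TopologicalSpace X] {S : Set X} {σ : X → E3}
    {ψ : X → R} (hY : Topology.IsInducing (M.domRestrict Y)) (hσ : ContinuousOn σ S)
    (hψ : MapsTo ψ S M) (hYψ : ∀ w ∈ S, Y (ψ w) = σ w) : ContinuousOn ψ S := by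
  rw [continuousOn_iff_continuous_domRestrict] at hσ ⊢
  have hlift : Continuous fun w : S => (⟨ψ w, hψ w.2⟩ : M) :=
    hY.continuous_iff.2 (hσ.congr fun w => (hYψ w w.2).symm)
  exact continuous_subtype_val.comp hlift

theorem exists_isGraphLift [Nonempty R] (hproper : IsProperMap (M.domRestrict Y))
    (hgraph : IsGraphOver Y M Ω) : ∃ φ : ℂ → R, IsGraphLift Y M Ω φ := by
  obtain ⟨hinj, u, hu, himg⟩ := hgraph
  let σ : ℂ → E3 := fun w => !₂[w.re, w.im, u w]
  have hσ : ContinuousOn σ Ω := by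
    refine (PiLp.continuous_toLp 2 _).comp_continuousOn (continuousOn_pi.2 fun i => ?_)
    fin_cases i
    exacts [Complex.continuous_re.continuousOn, Complex.continuous_im.continuousOn, hu]
  have hlift (w) (hw : w ∈ Ω) : ∃ p ∈ M, Y p = σ w := himg.symm.subset ⟨hw, rfl⟩
  have hY (p) (hp : p ∈ M) : proj (Y p) ∈ Ω ∧ Y p = σ (proj (Y p)) := by
    obtain ⟨hΩ, hu⟩ := himg.subset ⟨p, hp, rfl⟩
    refine ⟨hΩ, PiLp.ext fun i => ?_⟩
    fin_cases i
    exacts [rfl, rfl, hu]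
  choose! φ hφM hφ using hlift
  exact ⟨φ, continuousOn_of_comp_eq (isClosedEmbedding_domRestrict hproper hinj).isInducing hσ
    hφM hφ, hφM, fun w hw => by rw [hφ w hw]; rfl, fun p hp => (hY p hp).1, fun p hp =>
    hinj (hφM _ (hY p hp).1) hp ((hφ _ (hY p hp).1).trans (hY p hp).2.symm)⟩

theorem IsGraphLift.injOn (hφ : IsGraphLift Y M Ω φ) : InjOn (fun p => proj (Y p)) M :=
  LeftInvOn.injOn (f₁' := φ) hφ.apply_proj

theorem IsGraphLift.continuousAt (hφ : IsGraphLift Y M Ω φ) {w : ℂ} (hw : w ∈ interior Ω) :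
    ContinuousAt φ w :=
  hφ.continuousOn.continuousAt (mem_interior_iff_mem_nhds.1 hw)

variable [ChartedSpace ℂ R] [IsManifold 𝓘(ℂ) ω R]

theorem contDiffAt_proj_comp_symm (hY : ContMDiff 𝓘(ℝ, ℂ) 𝓘(ℝ, E3) ∞ Y)
    {e : OpenPartialHomeomorph R ℂ} (he : e ∈ atlas ℂ R) {x : ℂ} (hx : x ∈ e.target) :
    ContDiffAt ℝ ∞ (fun ζ => proj (Y (e.symm ζ))) x :=
  projCLM.contDiff.contDiffAt.comp x (contDiffAt_comp_symm hY he hx)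

theorem IsGraphLift.mapsTo_interior (hφ : IsGraphLift Y M Ω φ)
    (hY : ContMDiff 𝓘(ℝ, ℂ) 𝓘(ℝ, E3) ∞ Y) : MapsTo φ (interior Ω) (interior M) := by
  intro w hw
  let e := chartAt ℂ (φ w)
  have hps : φ w ∈ e.source := mem_chart_source ℂ _
  have hev : ∀ᶠ ζ in 𝓝 w, ζ ∈ Ω ∧ φ ζ ∈ e.source :=
    Filter.Eventually.and (mem_interior_iff_mem_nhds.1 hw)
      ((hφ.continuousAt hw).eventually_mem (e.open_source.mem_nhds hps))
  obtain ⟨ρ, hρ, hball⟩ := Metric.nhds_basis_closedBall.eventually_iff.1 hev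
  have himage : (e ∘ φ) '' Metric.closedBall w ρ ∈ 𝓝 (e (φ w)) :=
    image_closedBall_mem_nhds (q := fun ζ => proj (Y (e.symm ζ))) hρ
      (e.continuousOn.comp (hφ.continuousOn.mono fun ζ hζ => (hball hζ).1)
        fun ζ hζ => (hball hζ).2) e.open_target (fun ζ hζ => e.map_source (hball hζ).2)
      (fun ζ hζ => ((contDiffAt_proj_comp_symm hY (chart_mem_atlas ℂ _) hζ).differentiableAt
        (by simp)).differentiableWithinAt)
      fun ζ hζ => by rw [Function.comp_apply, e.left_inv (hball hζ).2, hφ.proj_apply ζ (hball hζ).1]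
  refine mem_interior_iff_mem_nhds.2 ?_
  filter_upwards [e.open_source.mem_nhds hps, (e.continuousAt hps).preimage_mem_nhds himage]
    with q hq ⟨ζ, hζ, hζq⟩
  exact e.injOn (hball hζ).2 hq hζq ▸ hφ.mapsTo (hball hζ).1

end GraphLift

section Lewy

theorem eq_zero_of_apply_eq_zero_of_apply_I_mul_eq_zero {l : ℂ →L[ℝ] ℝ} (hl : l ≠ 0) {w : ℂ}
    (hw : l w = 0) (hIw : l (Complex.I * w) = 0) : w = 0 := by
  by_contra hne
  refine hl (ContinuousLinearMap.ext fun v => ?_)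
  have hv : v = (v / w).re • w + (v / w).im • (Complex.I * w) := by
    rw [Complex.real_smul, Complex.real_smul, ← mul_assoc, ← add_mul, Complex.re_add_im,
      div_mul_cancel₀ v hne]
  rw [hv, map_add, map_smul, map_smul, hw, hIw, smul_zero, smul_zero, add_zero,
    zero_apply]

theorem fderiv_clm_comp_ne_zero_of_injOn {X : ℂ → ℂ} {x : ℂ} (hX : HarmonicAt X x) {U : Set ℂ}
    (hU : U ∈ 𝓝 x) (hinj : InjOn X U) {l : ℂ →L[ℝ] ℝ} (hl : l ≠ 0) :
    fderiv ℝ (fun ζ => l (X ζ)) x ≠ 0 := by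
  have hcont : ∀ᶠ ζ in 𝓝 x, ContinuousAt X ζ :=
    (hX.1.eventually (by simp)).mono fun ζ hζ => hζ.continuousAt
  refine fderiv_ne_zero_of_injOn (b := fun ζ => l (Complex.I * X ζ)) (hX.comp_CLM (l := l))
    (inter_mem hU hcont) (fun ζ hζ => (l.continuous.continuousAt.comp
      (continuousAt_const.mul hζ.2)).continuousWithinAt) fun ζ hζ ξ hξ h => ?_
  obtain ⟨hre, him⟩ := Prod.mk.inj h
  refine hinj hζ.1 hξ.1 (sub_eq_zero.1
    (eq_zero_of_apply_eq_zero_of_apply_I_mul_eq_zero hl ?_ ?_))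
  · rw [map_sub, hre, sub_self]
  · rw [mul_sub, map_sub, him, sub_self]

theorem exists_hasFDerivAt_equiv_of_harmonicAt_of_injOn {X : ℂ → ℂ} {x : ℂ} (hX : HarmonicAt X x)
    {U : Set ℂ} (hU : U ∈ 𝓝 x) (hinj : InjOn X U) :
    ∃ L : ℂ ≃L[ℝ] ℂ, HasFDerivAt X (L : ℂ →L[ℝ] ℂ) x := by
  have hd : HasFDerivAt X (fderiv ℝ X x) x := (hX.1.differentiableAt two_ne_zero).hasFDerivAt
  have hsurj : Function.Surjective (fderiv ℝ X x : ℂ →ₗ[ℝ] ℂ) := by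
    rw [← LinearMap.range_eq_top]
    by_contra hne
    obtain ⟨l, hl, hle⟩ := Submodule.exists_le_ker_of_lt_top _ (lt_top_iff_ne_top.2 hne)
    refine fderiv_clm_comp_ne_zero_of_injOn hX hU hinj (l := l.toContinuousLinearMap)
      (fun h => hl (LinearMap.ext fun v => DFunLike.congr_fun h v)) ?_
    have := (l.toContinuousLinearMap.hasFDerivAt.comp x hd).fderiv
    exact this.trans (ContinuousLinearMap.ext fun v => hle ⟨v, rfl⟩)
  exact ⟨(LinearEquiv.ofBijective (fderiv ℝ X x : ℂ →ₗ[ℝ] ℂ)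
    ⟨LinearMap.injective_iff_surjective.2 hsurj, hsurj⟩).toContinuousLinearEquiv, hd⟩

variable {R : Type*} [TopologicalSpace R] [ChartedSpace ℂ R] [IsManifold 𝓘(ℂ) ω R]
  {Y : R → E3} {M B : Set R} {Ω : Set ℂ} {φ : ℂ → R} {e : OpenPartialHomeomorph R ℂ} {x : ℂ}

theorem IsGraphLift.exists_hasFDerivAt_equiv (hφ : IsGraphLift Y M Ω φ)
    (hM : IsSurfaceWithBoundary M B) (hY : IsConformalMinimalImmersion Y M B)
    (he : e ∈ atlas ℂ R) (hx : x ∈ e.target) (hxM : e.symm x ∈ interior M) :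
    ∃ L : ℂ ≃L[ℝ] ℂ, HasFDerivAt (fun ζ => proj (Y (e.symm ζ))) (L : ℂ →L[ℝ] ℂ) x :=
  exists_hasFDerivAt_equiv_of_harmonicAt_of_injOn
    ((hY.harmonicAt_comp_symm hM he hx hxM).comp_CLM (l := projCLM))
    (eventually_mem_target_and_symm_mem_interior hx hxM) fun _ hζ _ hξ h =>
      e.symm.injOn hζ.1 hξ.1 (hφ.injOn (interior_subset hζ.2) (interior_subset hξ.2) h)

theorem IsGraphLift.proj_mem_interior (hφ : IsGraphLift Y M Ω φ)
    (hM : IsSurfaceWithBoundary M B) (hY : IsConformalMinimalImmersion Y M B)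
    {p : R} (hpM : p ∈ interior M) : proj (Y p) ∈ interior Ω := by
  let e := chartAt ℂ p
  have he : e ∈ atlas ℂ R := chart_mem_atlas ℂ p
  have hx : e p ∈ e.target := mem_chart_target ℂ p
  have hxp : e.symm (e p) = p := e.left_inv (mem_chart_source ℂ p)
  obtain ⟨L, hL⟩ := hφ.exists_hasFDerivAt_equiv hM hY he hx (by rwa [hxp])
  have hopen := ((contDiffAt_proj_comp_symm hY.smooth he hx).hasStrictFDerivAt' hL
    (by simp)).map_nhds_eq_of_equiv
  rw [hxp] at hopen
  rw [mem_interior_iff_mem_nhds, ← hopen]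
  exact (eventually_mem_target_and_symm_mem_interior hx (by rwa [hxp])).mono fun ζ hζ =>
    hφ.proj_mem _ (interior_subset hζ.2)

theorem IsGraphLift.contDiffAt_chart_comp (hφ : IsGraphLift Y M Ω φ)
    (hM : IsSurfaceWithBoundary M B) (hY : IsConformalMinimalImmersion Y M B)
    (he : e ∈ atlas ℂ R) {w : ℂ} (hw : w ∈ interior Ω) (hwe : φ w ∈ e.source) :
    ContDiffAt ℝ ∞ (e ∘ φ) w := by
  have hx : e (φ w) ∈ e.target := e.map_source hwe
  have hxM : e.symm (e (φ w)) ∈ interior M := by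
    rw [e.left_inv hwe]
    exact hφ.mapsTo_interior hY.smooth hw
  obtain ⟨L, hL⟩ := hφ.exists_hasFDerivAt_equiv hM hY he hx hxM
  have hX := contDiffAt_proj_comp_symm hY.smooth he hx
  have hX0 : (∞ : WithTop ℕ∞) ≠ 0 := by simp
  let g := hX.localInverse hL hX0
  have hg : ContDiffAt ℝ ∞ g (proj (Y (e.symm (e (φ w))))) := hX.to_localInverse hL hX0
  have hgw : g (proj (Y (e.symm (e (φ w))))) = e (φ w) := hX.localInverse_apply_image hL hX0
  have hright : ∀ᶠ ζ in 𝓝 (proj (Y (e.symm (e (φ w))))), proj (Y (e.symm (g ζ))) = ζ :=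
    (hX.hasStrictFDerivAt' hL hX0).eventually_right_inverse
  rw [e.left_inv hwe, hφ.proj_apply w (interior_subset hw)] at hg hgw hright
  refine hg.congr_of_eventuallyEq ?_
  filter_upwards [hright, hg.continuousAt.eventually (hgw ▸
    eventually_mem_target_and_symm_mem_interior hx hxM)] with ζ hζ ⟨hgt, hgM⟩
  rw [← hζ, Function.comp_apply, hφ.apply_proj _ (interior_subset hgM), e.right_inv hgt, hζ]

end Lewy

section Conjugate

theorem starConvex_interior {E : Type*} [AddCommGroup E] [Module ℝ E] [TopologicalSpace E]
    [ContinuousAdd E] [ContinuousConstSMul ℝ E] {a : E} {s : Set E} (ha : a ∈ interior s)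
    (hstar : StarConvex ℝ a s) : StarConvex ℝ a (interior s) := by
  intro x hx c d hc hd hcd
  rcases hd.eq_or_lt with rfl | hd
  · rwa [zero_smul, add_zero, (add_zero c).symm.trans hcd, one_smul]
  · refine interior_maximal ?_ (((isOpenMap_add_left (c • a)).comp (isOpenMap_smul₀ hd.ne')) _
      isOpen_interior) ⟨x, hx, rfl⟩
    rintro _ ⟨y, hy, rfl⟩
    exact hstar (interior_subset hy) hc hd.le hcd

/-- The conjugate coordinate of a minimal graph: a global function `Φ` on the interior of the
planar domain, pulled back to a holomorphic function on the surface, whose imaginary part is the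
second coordinate. It is normalized by `Φ z₀ = 0`. -/
structure IsConjugateCoordinate {R : Type*} [TopologicalSpace R] [ChartedSpace ℂ R] (Y : R → E3)
    (M : Set R) (Ω : Set ℂ) (z₀ : ℂ) (Φ : ℂ → ℂ) : Prop where
  map_base : Φ z₀ = 0
  im_apply : ∀ w, (Φ w).im = w.im - z₀.im
  differentiableAt : ∀ w ∈ interior Ω, DifferentiableAt ℝ Φ w
  isHolomorphicAt : ∀ p ∈ interior M, IsHolomorphicAt (fun q => Φ (proj (Y q))) p

variable {R : Type*} [TopologicalSpace R] [ChartedSpace ℂ R]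
  {Y : R → E3} {M B : Set R} {Ω : Set ℂ} {φ : ℂ → R} {z₀ : ℂ} {Φ : ℂ → ℂ}

theorem IsConjugateCoordinate.im_fderiv (hΦ : IsConjugateCoordinate Y M Ω z₀ Φ) {w : ℂ}
    (hw : w ∈ interior Ω) (v : ℂ) : (fderiv ℝ Φ w v).im = v.im := by
  have him : HasFDerivAt (fun ζ => (Φ ζ).im) (Complex.imCLM ∘L fderiv ℝ Φ w) w :=
    Complex.imCLM.hasFDerivAt.comp w (hΦ.differentiableAt w hw).hasFDerivAt
  simp only [hΦ.im_apply] at him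
  exact DFunLike.congr_fun (him.unique (Complex.imCLM.hasFDerivAt.sub_const z₀.im)) v

variable [IsManifold 𝓘(ℂ) ω R]

theorem IsGraphLift.contDiffAt_comp (hφ : IsGraphLift Y M Ω φ) (hM : IsSurfaceWithBoundary M B)
    (hY : IsConformalMinimalImmersion Y M B) {G : R → ℂ} {w : ℂ} (hw : w ∈ interior Ω)
    (hG : IsHolomorphicAt G (φ w)) : ContDiffAt ℝ 2 (fun ζ => G (φ ζ)) w := by
  let e := chartAt ℂ (φ w)
  have he : e ∈ atlas ℂ R := chart_mem_atlas ℂ _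
  have hwe : φ w ∈ e.source := mem_chart_source ℂ _
  have hchart : ContDiffAt ℝ 2 (e ∘ φ) w :=
    (hφ.contDiffAt_chart_comp hM hY he hw hwe).of_le ENat.LEInfty.out
  have hGe : ContDiffAt ℝ 2 (G ∘ e.symm) (e (φ w)) := (hG e he hwe).contDiffAt.restrict_scalars ℝ
  refine (hGe.comp w hchart).congr_of_eventuallyEq ?_
  filter_upwards [(hφ.continuousAt hw).eventually_mem (e.open_source.mem_nhds hwe)] with ζ hζ
  exact congrArg G (e.left_inv hζ).symm

theorem IsGraphLift.exists_re_eventually_sub_eq (hφ : IsGraphLift Y M Ω φ)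
    (hM : IsSurfaceWithBoundary M B) (hY : IsConformalMinimalImmersion Y M B)
    (hz₀ : z₀ ∈ interior Ω) (hstar : StarConvex ℝ z₀ Ω) {G : R → R → ℂ}
    (hG : ∀ p ∈ interior M, IsHolomorphicAt (G p) p)
    (him : ∀ p ∈ interior M, ∀ᶠ q in 𝓝 p, (G p q).im = (proj (Y q)).im) :
    ∃ Q : ℂ → ℝ, ∀ w ∈ interior Ω,
      ∀ᶠ ζ in 𝓝 w, Q ζ - (G (φ w) (φ ζ)).re = Q w - (G (φ w) (φ w)).re := by
  refine exists_eventually_sub_eq_of_local_potentials (P := fun w ζ => (G (φ w) (φ ζ)).re)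
    isOpen_interior (starConvex_interior hz₀ hstar)
    (fun w hw => Complex.reCLM.contDiff.contDiffAt.comp w
      (hφ.contDiffAt_comp hM hY hw (hG _ (hφ.mapsTo_interior hY.smooth hw)))) fun w hw => ?_
  have hwM := hφ.mapsTo_interior hY.smooth hw
  filter_upwards [isOpen_interior.mem_nhds hw,
    (hφ.continuousAt hw).eventually (hG _ hwM).eventually,
    (hφ.continuousAt hw).eventually (him _ hwM).eventually_nhds] with ζ hζ hGζ himζ
  have hζM := hφ.mapsTo_interior hY.smooth hζ
  have hsub := (hG _ hζM).eventually_sub_eq hGζ (by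
    filter_upwards [him _ hζM, himζ] with q hq hq' using hq.trans hq'.symm)
  filter_upwards [(hφ.continuousAt hζ).eventually hsub] with ξ hξ
  exact congrArg Complex.re hξ

theorem IsGraphLift.exists_isConjugateCoordinate (hφ : IsGraphLift Y M Ω φ)
    (hM : IsSurfaceWithBoundary M B) (hY : IsConformalMinimalImmersion Y M B)
    (hz₀ : z₀ ∈ interior Ω) (hstar : StarConvex ℝ z₀ Ω) :
    ∃ Φ : ℂ → ℂ, IsConjugateCoordinate Y M Ω z₀ Φ := by
  choose! G hG him using fun p (hp : p ∈ interior M) => exists_eventually_im_eq_im_proj hY hM hp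
  obtain ⟨Q, hQ⟩ := hφ.exists_re_eventually_sub_eq hM hY hz₀ hstar hG him
  let Φ : ℂ → ℂ := fun w => ⟨Q w - Q z₀, w.im - z₀.im⟩
  have hΦG (w) (hw : w ∈ interior Ω) :
      ∀ᶠ ζ in 𝓝 w, Φ ζ = G (φ w) (φ ζ) + (Φ w - G (φ w) (φ w)) := by
    have himw := him _ (hφ.mapsTo_interior hY.smooth hw)
    filter_upwards [hQ w hw, isOpen_interior.mem_nhds hw, (hφ.continuousAt hw).eventually himw]
      with ζ hζ hζΩ himζ
    rw [hφ.proj_apply ζ (interior_subset hζΩ)] at himζ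
    have himw' := himw.self_of_nhds
    rw [hφ.proj_apply w (interior_subset hw)] at himw'
    refine Complex.ext ?_ ?_ <;> simp only [Φ, Complex.add_re, Complex.sub_re, Complex.add_im,
      Complex.sub_im] <;> linarith
  refine ⟨Φ, Complex.ext (sub_self _) (sub_self _), fun _ => rfl, fun w hw => ?_, fun p hp => ?_⟩
  · exact (((hφ.contDiffAt_comp hM hY hw (hG _ (hφ.mapsTo_interior hY.smooth hw))).differentiableAt
      two_ne_zero).add_const _).congr_of_eventuallyEq (hΦG w hw)
  · have hpΩ := hφ.proj_mem_interior hM hY hp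
    have hφp := hφ.apply_proj p (interior_subset hp)
    intro e he hpe
    refine ((hG p hp e he hpe).add (analyticAt_const (v := Φ (proj (Y p)) - G p p))).congr ?_
    have hcont : Tendsto (fun q => proj (Y q)) (𝓝 p) (𝓝 (proj (Y p))) :=
      (projCLM.continuous.comp hY.smooth.continuous).tendsto p
    filter_upwards [(e.tendsto_symm hpe).eventually (hcont.eventually (hΦG _ hpΩ)),
      (e.tendsto_symm hpe).eventually_mem (isOpen_interior.mem_nhds hp)] with ζ hζ hζM
    rw [hφ.apply_proj _ (interior_subset hζM), hφp] at hζ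
    exact hζ.symm

theorem IsConjugateCoordinate.exists_fderiv_eq_mul (hΦ : IsConjugateCoordinate Y M Ω z₀ Φ)
    (hφ : IsGraphLift Y M Ω φ) (hM : IsSurfaceWithBoundary M B)
    (hY : IsConformalMinimalImmersion Y M B) {w : ℂ} (hw : w ∈ interior Ω) :
    ∃ (L : ℂ ≃L[ℝ] ℂ) (d : ℂ), ∀ v, fderiv ℝ Φ w v = d * L v := by
  let e := chartAt ℂ (φ w)
  have he : e ∈ atlas ℂ R := chart_mem_atlas ℂ _
  have hwe : φ w ∈ e.source := mem_chart_source ℂ _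
  have hwM := hφ.mapsTo_interior hY.smooth hw
  obtain ⟨L, hL⟩ := hφ.exists_hasFDerivAt_equiv hM hY he (e.map_source hwe)
    (by rwa [e.left_inv hwe])
  have hbase : proj (Y (e.symm (e (φ w)))) = w := by
    rw [e.left_inv hwe, hφ.proj_apply w (interior_subset hw)]
  have hΦw : HasFDerivAt Φ (fderiv ℝ Φ w) (proj (Y (e.symm (e (φ w))))) := by
    rw [hbase]
    exact (hΦ.differentiableAt w hw).hasFDerivAt
  have hcomp := (hΦw.comp (e (φ w)) hL).unique
    (hΦ.isHolomorphicAt _ hwM e he hwe).differentiableAt.hasDerivAt.complexToReal_fderiv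
  refine ⟨L.symm, deriv ((fun q => Φ (proj (Y q))) ∘ e.symm) (e (φ w)), fun v => ?_⟩
  simpa using DFunLike.congr_fun hcomp (L.symm v)

theorem IsConjugateCoordinate.re_fderiv_one_ne_zero (hΦ : IsConjugateCoordinate Y M Ω z₀ Φ)
    (hφ : IsGraphLift Y M Ω φ) (hM : IsSurfaceWithBoundary M B)
    (hY : IsConformalMinimalImmersion Y M B) {w : ℂ} (hw : w ∈ interior Ω) :
    (fderiv ℝ Φ w 1).re ≠ 0 := by
  intro hre
  obtain ⟨L, d, hd⟩ := hΦ.exists_fderiv_eq_mul hφ hM hY hw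
  have hone : d * L 1 = 0 :=
    (hd 1).symm.trans (Complex.ext hre ((hΦ.im_fderiv hw 1).trans Complex.one_im))
  have hd0 : d = 0 :=
    (mul_eq_zero.1 hone).resolve_right fun h => one_ne_zero (L.map_eq_zero_iff.1 h)
  have him := hΦ.im_fderiv hw Complex.I
  rw [hd, hd0, zero_mul] at him
  exact zero_ne_one him

end Conjugate

section HarmonicFunctions

theorem harmonicAt_abs {E : Type*} [NormedAddCommGroup E] [InnerProductSpace ℝ E]
    [FiniteDimensional ℝ E] {f : E → ℝ} {x : E} (hf : HarmonicAt f x) (hx : f x ≠ 0) :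
    HarmonicAt (fun y => |f y|) x := by
  rcases hx.lt_or_gt with hx | hx
  · exact (harmonicAt_congr_nhds ((hf.1.continuousAt.eventually_lt_const hx).mono
      fun y hy => abs_of_neg hy)).2 hf.neg
  · exact (harmonicAt_congr_nhds ((hf.1.continuousAt.eventually_const_lt hx).mono
      fun y hy => abs_of_pos hy)).2 hf

namespace IsHarmonicAt

variable {R : Type*} [TopologicalSpace R] [ChartedSpace ℂ R] {f g : R → ℝ} {p : R}

theorem sub (hf : IsHarmonicAt f p) (hg : IsHarmonicAt g p) :
    IsHarmonicAt (fun q => f q - g q) p :=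
  fun e he hp => (hf e he hp).sub (hg e he hp)

theorem sub_const (hf : IsHarmonicAt f p) (c : ℝ) : IsHarmonicAt (fun q => f q - c) p :=
  hf.sub fun _ _ _ => harmonicAt_const c

theorem const_mul (hf : IsHarmonicAt f p) (c : ℝ) : IsHarmonicAt (fun q => c * f q) p :=
  fun e he hp => (hf e he hp).const_smul

theorem abs (hf : IsHarmonicAt f p) (hp : f p ≠ 0) : IsHarmonicAt (fun q => |f q|) p :=
  fun e he hpe => harmonicAt_abs (hf e he hpe) (by rwa [e.left_inv hpe])

end IsHarmonicAt

end HarmonicFunctions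

section SlabBarrier

theorem slabBarrier_add_sq_nonneg {h t₀ c : ℝ} {x : E3} (hr : 1 ≤ x 0 ^ 2 + (x 2 - h) ^ 2)
    (hx : |x 1 - t₀| ≤ c) : 0 ≤ slabBarrier h t₀ x + c ^ 2 := by
  have hlog := Real.log_nonneg hr
  have hsq : (x 1 - t₀) ^ 2 ≤ c ^ 2 := sq_le_sq' (neg_le_of_abs_le hx) (le_of_abs_le hx)
  rw [slabBarrier]
  linarith

theorem continuousAt_slabBarrier {h : ℝ} (t₀ : ℝ) {x : E3}
    (hr : x 0 ^ 2 + (x 2 - h) ^ 2 ≠ 0) : ContinuousAt (slabBarrier h t₀) x :=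
  have hsq : Continuous fun y : E3 => y 0 ^ 2 + (y 2 - h) ^ 2 := by fun_prop
  have hlin : Continuous fun y : E3 => (y 1 - t₀) ^ 2 := by fun_prop
  ((hsq.continuousAt.log hr).const_mul (1 / 2)).sub hlin.continuousAt

theorem sq_norm_le_of_slabBarrier_le {h t₀ c K : ℝ} {x : E3}
    (hr : 0 < x 0 ^ 2 + (x 2 - h) ^ 2) (hx : |x 1 - t₀| ≤ c) (hK : slabBarrier h t₀ x ≤ K) :
    ‖x‖ ^ 2 ≤ 2 * Real.exp (2 * (K + c ^ 2)) + 2 * h ^ 2 + 2 * c ^ 2 + 2 * t₀ ^ 2 := by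
  have hsq : (x 1 - t₀) ^ 2 ≤ c ^ 2 := sq_le_sq' (neg_le_of_abs_le hx) (le_of_abs_le hx)
  have hexp : x 0 ^ 2 + (x 2 - h) ^ 2 ≤ Real.exp (2 * (K + c ^ 2)) := by
    rw [← Real.log_le_iff_le_exp hr]
    rw [slabBarrier] at hK
    linarith
  rw [EuclideanSpace.real_norm_sq_eq, Fin.sum_univ_three]
  nlinarith only [hsq, hexp, sq_nonneg (x 2 - 2 * h), sq_nonneg (x 1 - 2 * t₀), sq_nonneg (x 0)]

/-- The comparison function of the maximum principle on the slab `|x 1 - t₀| ≤ c` for functions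
bounded by `C`: it is at least `C` on both faces, and its barrier term, scaled by `δ`, makes it
exceed `C` near infinity. -/
def slabMajorant (C c δ h t₀ : ℝ) (x : E3) : ℝ :=
  C / c * |x 1 - t₀| + δ * (slabBarrier h t₀ x + c ^ 2)

section SlabMajorant

variable {C c δ h t₀ : ℝ} {x : E3}

theorem slabMajorant_nonneg (hC : 0 ≤ C) (hδ : 0 ≤ δ) (hr : 1 ≤ x 0 ^ 2 + (x 2 - h) ^ 2)
    (hx : |x 1 - t₀| ≤ c) : 0 ≤ slabMajorant C c δ h t₀ x :=
  add_nonneg (mul_nonneg (div_nonneg hC ((abs_nonneg _).trans hx)) (abs_nonneg _))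
    (mul_nonneg hδ (slabBarrier_add_sq_nonneg hr hx))

theorem le_slabMajorant_of_abs_eq (hc : c ≠ 0) (hδ : 0 ≤ δ)
    (hr : 1 ≤ x 0 ^ 2 + (x 2 - h) ^ 2) (hx : |x 1 - t₀| = c) :
    C ≤ slabMajorant C c δ h t₀ x := by
  rw [slabMajorant, hx, div_mul_cancel₀ C hc]
  exact le_add_of_nonneg_right (mul_nonneg hδ (slabBarrier_add_sq_nonneg hr hx.le))

theorem slabBarrier_lt_of_slabMajorant_lt (hC : 0 ≤ C) (hc : 0 ≤ c) (hδ : 0 < δ)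
    (hx : slabMajorant C c δ h t₀ x < C) : slabBarrier h t₀ x < C / δ := by
  have hlin : 0 ≤ C / c * |x 1 - t₀| := by positivity
  rw [slabMajorant] at hx
  rw [lt_div_iff₀' hδ]
  nlinarith only [hlin, hx, mul_nonneg hδ.le (sq_nonneg c)]

theorem continuousAt_slabMajorant (hr : x 0 ^ 2 + (x 2 - h) ^ 2 ≠ 0) :
    ContinuousAt (slabMajorant C c δ h t₀) x :=
  have hlin : Continuous fun y : E3 => C / c * |y 1 - t₀| := by fun_prop
  hlin.continuousAt.add (((continuousAt_slabBarrier t₀ hr).add_const _).const_mul δ)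

end SlabMajorant

variable {R : Type*} [TopologicalSpace R] {Y : R → E3} {M : Set R} {Ω : Set ℂ} {φ : ℂ → R}

theorem isCompact_inter_preimage {X : Type*} [TopologicalSpace X] {Y : R → X}
    (hproper : IsProperMap (M.domRestrict Y)) {K : Set X} (hK : IsCompact K) :
    IsCompact (M ∩ Y ⁻¹' K) := by
  have h := (hproper.isCompact_preimage hK).image continuous_subtype_val
  rwa [domRestrict_eq, preimage_comp, Subtype.image_preimage_coe] at h

theorem isCompact_slabBarrier_le (hproper : IsProperMap (M.domRestrict Y)) (hM : IsClosed M)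
    (hY : Continuous Y) {h t₀ c : ℝ}
    (hr : ∀ q ∈ M, |Y q 1 - t₀| ≤ c → 1 ≤ Y q 0 ^ 2 + (Y q 2 - h) ^ 2) (K : ℝ) :
    IsCompact {q ∈ M | |Y q 1 - t₀| ≤ c ∧ slabBarrier h t₀ (Y q) ≤ K} := by
  let S : Set R := M ∩ {q | |Y q 1 - t₀| ≤ c}
  let D := 2 * Real.exp (2 * (K + c ^ 2)) + 2 * h ^ 2 + 2 * c ^ 2 + 2 * t₀ ^ 2
  have hS : IsClosed S := hM.inter (isClosed_le (by fun_prop) continuous_const)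
  have hcont : ContinuousOn (fun q => slabBarrier h t₀ (Y q)) S := fun q hq =>
    ((continuousAt_slabBarrier t₀ (one_pos.trans_le (hr q hq.1 hq.2)).ne').comp
      hY.continuousAt).continuousWithinAt
  have hA : IsClosed (S ∩ {q | slabBarrier h t₀ (Y q) ≤ K}) :=
    hcont.preimage_isClosed_of_isClosed hS isClosed_Iic
  have hAD : S ∩ {q | slabBarrier h t₀ (Y q) ≤ K} ⊆ M ∩ Y ⁻¹' Metric.closedBall 0 √D := by
    rintro q ⟨⟨hqM, hqc⟩, hqK⟩
    exact ⟨hqM, mem_closedBall_zero_iff.2 (Real.le_sqrt_of_sq_le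
      (sq_norm_le_of_slabBarrier_le (one_pos.trans_le (hr q hqM hqc)) hqc hqK))⟩
  have hcompact :=
    (isCompact_inter_preimage hproper (isCompact_closedBall 0 √D)).of_isClosed_subset hA hAD
  rwa [inter_assoc] at hcompact

theorem IsGraphLift.exists_one_le_sq_add_sq (hφ : IsGraphLift Y M Ω φ) (hΩ : IsClosed Ω)
    (hY : Continuous Y) (t₀ c : ℝ) :
    ∃ h : ℝ, ∀ q ∈ M, |Y q 1 - t₀| ≤ c → 1 ≤ Y q 0 ^ 2 + (Y q 2 - h) ^ 2 := by
  have hcompact : IsCompact (Ω ∩ (Icc (-1) 1 ×ℂ Icc (t₀ - c) (t₀ + c))) :=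
    (isCompact_Icc.reProdIm isCompact_Icc).inter_left hΩ
  have hcoord : Continuous fun x : E3 => x 2 := by fun_prop
  obtain ⟨H, hH⟩ := hcompact.exists_bound_of_continuousOn
    ((hcoord.comp hY).comp_continuousOn (hφ.continuousOn.mono inter_subset_left))
  refine ⟨H + 1, fun q hq hqc => ?_⟩
  by_cases hq0 : |Y q 0| ≤ 1
  · have hq2 : |Y q 2| ≤ H := by
      have hbound := hH (proj (Y q)) ⟨hφ.proj_mem q hq, abs_le.1 hq0,
        mem_Icc_iff_abs_le.1 ((abs_sub_comm _ _).trans_le hqc)⟩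
      rwa [Function.comp_apply, Function.comp_apply, hφ.apply_proj q hq] at hbound
    nlinarith only [abs_le.1 hq2, sq_nonneg (Y q 0)]
  · have hq0' : 1 ≤ Y q 0 ^ 2 := (one_le_sq_iff_one_le_abs _).2 (not_le.1 hq0).le
    exact le_add_of_le_of_nonneg hq0' (sq_nonneg _)

end SlabBarrier

section MaximumPrinciple

variable {R : Type*} [TopologicalSpace R] [ChartedSpace ℂ R] [IsManifold 𝓘(ℂ) ω R]
  {Y : R → E3} {M B : Set R} {Ω : Set ℂ} {φ : ℂ → R}

theorem IsConformalMinimalImmersion.isHarmonicAt_coord (hY : IsConformalMinimalImmersion Y M B)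
    (hM : IsSurfaceWithBoundary M B) {p : R} (hp : p ∈ interior M) (i : Fin 3) :
    IsHarmonicAt (fun q => Y q i) p := fun e he hpe =>
  (hY.harmonicAt_comp_symm hM he (e.map_source hpe) (by rwa [e.left_inv hpe])).comp_CLM
    (l := EuclideanSpace.proj i)

theorem IsConformalMinimalImmersion.fderiv_coord_one_ne_zero
    (hY : IsConformalMinimalImmersion Y M B) (hM : IsSurfaceWithBoundary M B)
    (hinj : InjOn (fun p => proj (Y p)) M) {e : OpenPartialHomeomorph R ℂ} (he : e ∈ atlas ℂ R)
    {x : ℂ} (hx : x ∈ e.target) (hxM : e.symm x ∈ interior M) :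
    fderiv ℝ (fun ζ => (Y ∘ e.symm) ζ 1) x ≠ 0 :=
  fderiv_clm_comp_ne_zero_of_injOn (l := Complex.imCLM)
    ((hY.harmonicAt_comp_symm hM he hx hxM).comp_CLM (l := projCLM))
    (eventually_mem_target_and_symm_mem_interior hx hxM)
    (fun _ hζ _ hξ h => e.symm.injOn hζ.1 hξ.1
      (hinj (interior_subset hζ.2) (interior_subset hξ.2) h))
    fun h => one_ne_zero (DFunLike.congr_fun h Complex.I)

theorem not_isLocalMax_sub_slabBarrier (hM : IsSurfaceWithBoundary M B)
    (hY : IsConformalMinimalImmersion Y M B) (hinj : InjOn (fun p => proj (Y p)) M)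
    {H : R → ℝ} {p : R} (hp : p ∈ interior M) (hH : IsHarmonicAt H p) {h δ : ℝ} (t₀ : ℝ)
    (hδ : 0 < δ) (hr : 1 ≤ Y p 0 ^ 2 + (Y p 2 - h) ^ 2) :
    ¬ IsLocalMax (fun q => H q - δ * slabBarrier h t₀ (Y q)) p := by
  intro hmax
  let e := chartAt ℂ p
  have he : e ∈ atlas ℂ R := chart_mem_atlas ℂ p
  have hpe : p ∈ e.source := mem_chart_source ℂ p
  have hx : e p ∈ e.target := e.map_source hpe
  have hxp : e.symm (e p) = p := e.left_inv hpe
  have hxM : e.symm (e p) ∈ interior M := by rwa [hxp]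
  have hHx : HarmonicAt (H ∘ e.symm) (e p) := hH e he hpe
  have hYx : ContDiffAt ℝ 2 (Y ∘ e.symm) (e p) :=
    (contDiffAt_comp_symm hY.smooth he hx).of_le ENat.LEInfty.out
  have hrx : 1 ≤ (Y ∘ e.symm) (e p) 0 ^ 2 + ((Y ∘ e.symm) (e p) 2 - h) ^ 2 := by
    rwa [Function.comp_apply, hxp]
  have hbx : ContDiffAt ℝ 2 (slabBarrier h t₀ ∘ (Y ∘ e.symm)) (e p) :=
    contDiffAt_slabBarrier_comp hYx t₀ (one_pos.trans_le hrx).ne'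
  have hneg : Δ (slabBarrier h t₀ ∘ (Y ∘ e.symm)) (e p) < 0 :=
    laplacian_slabBarrier_comp_neg hYx (hY.laplacian_comp_symm_eq_zero hM he hx hxM)
      (hY.isWeaklyConformalAt_comp_symm hM he hx hxM) t₀ hrx
      (hY.fderiv_coord_one_ne_zero hM hinj he hx hxM)
  have hδb : ContDiffAt ℝ 2 (δ • (slabBarrier h t₀ ∘ (Y ∘ e.symm))) (e p) := hbx.const_smul δ
  have hle : Δ (H ∘ e.symm - δ • (slabBarrier h t₀ ∘ (Y ∘ e.symm))) (e p) ≤ 0 := by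
    refine laplacian_nonpos_of_isLocalMax (hHx.1.sub hδb) ?_
    filter_upwards [(e.tendsto_symm hpe).eventually hmax] with ζ hζ
    simpa [hxp] using hζ
  rw [hHx.1.laplacian_sub hδb, laplacian_smul δ hbx, hHx.2.self_of_nhds, Pi.zero_apply, zero_sub,
    smul_eq_mul, neg_nonpos] at hle
  exact hle.not_gt (mul_neg_of_pos_of_neg hδ hneg)

theorem not_isLocalMax_sub_slabMajorant (hM : IsSurfaceWithBoundary M B)
    (hY : IsConformalMinimalImmersion Y M B) (hinj : InjOn (fun p => proj (Y p)) M) {G : R → ℝ}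
    {p : R} (hp : p ∈ interior M) (hG : IsHarmonicAt G p) {h δ t₀ : ℝ} (C c : ℝ) (hδ : 0 < δ)
    (hr : 1 ≤ Y p 0 ^ 2 + (Y p 2 - h) ^ 2) (hpt : Y p 1 ≠ t₀) :
    ¬ IsLocalMax (fun q => G q - slabMajorant C c δ h t₀ (Y q)) p := by
  have hlin : IsHarmonicAt (fun q => |Y q 1 - t₀|) p :=
    ((hY.isHarmonicAt_coord hM hp 1).sub_const t₀).abs (sub_ne_zero.2 hpt)
  have h := not_isLocalMax_sub_slabBarrier hM hY hinj hp
    ((hG.sub (hlin.const_mul (C / c))).sub_const (δ * c ^ 2)) t₀ hδ hr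
  convert h using 2
  funext q
  simp only [slabMajorant]
  ring

theorem le_slabMajorant (hM : IsSurfaceWithBoundary M B)
    (hY : IsConformalMinimalImmersion Y M B) (hinj : InjOn (fun p => proj (Y p)) M)
    (hproper : IsProperMap (M.domRestrict Y)) {t₀ h c δ C : ℝ} (hc : 0 < c) (hδ : 0 < δ)
    (hC : 0 ≤ C) (hr : ∀ q ∈ M, |Y q 1 - t₀| ≤ c → 1 ≤ Y q 0 ^ 2 + (Y q 2 - h) ^ 2) {G : R → ℝ}
    (husc : UpperSemicontinuousOn G M) (hGC : ∀ q ∈ M, G q ≤ C) (hGB : ∀ q ∈ B, G q ≤ 0)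
    (hG₀ : ∀ q ∈ M, Y q 1 = t₀ → G q ≤ 0)
    (hG : ∀ q ∈ M \ B, Y q 1 ≠ t₀ → IsHarmonicAt G q) {p : R} (hp : p ∈ M)
    (hpc : |Y p 1 - t₀| ≤ c) : G p ≤ slabMajorant C c δ h t₀ (Y p) := by
  by_contra! hlt
  let A : Set R := {q ∈ M | |Y q 1 - t₀| ≤ c ∧ slabBarrier h t₀ (Y q) ≤ C / δ}
  have hYc : Continuous Y := hY.smooth.continuous
  have hr0 (q) (hq : q ∈ M) (hqc : |Y q 1 - t₀| ≤ c) : Y q 0 ^ 2 + (Y q 2 - h) ^ 2 ≠ 0 :=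
    (one_pos.trans_le (hr q hq hqc)).ne'
  have hinside (q) (hq : q ∈ M) (hqc : |Y q 1 - t₀| ≤ c)
      (hGq : slabMajorant C c δ h t₀ (Y q) < G q) :
      q ∈ M \ B ∧ Y q 1 ≠ t₀ ∧ |Y q 1 - t₀| < c ∧ slabBarrier h t₀ (Y q) < C / δ := by
    have hpos : 0 < G q := (slabMajorant_nonneg hC hδ.le (hr q hq hqc) hqc).trans_lt hGq
    have hltC := hGq.trans_le (hGC q hq)
    exact ⟨⟨hq, fun hqB => hpos.not_ge (hGB q hqB)⟩, fun h => hpos.not_ge (hG₀ q hq h),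
      hqc.lt_of_ne fun h => hltC.not_ge (le_slabMajorant_of_abs_eq hc.ne' hδ.le (hr q hq hqc) h),
      slabBarrier_lt_of_slabMajorant_lt hC hc.le hδ hltC⟩
  have hpA : p ∈ A := ⟨hp, hpc, (hinside p hp hpc hlt).2.2.2.le⟩
  have husc' : UpperSemicontinuousOn (fun q => G q + -slabMajorant C c δ h t₀ (Y q)) A :=
    (husc.mono fun q hq => hq.1).add (ContinuousOn.upperSemicontinuousOn fun q hq =>
      ((continuousAt_slabMajorant (hr0 q hq.1 hq.2.1)).comp
        hYc.continuousAt).neg.continuousWithinAt)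
  obtain ⟨q, hqA, hmax⟩ := husc'.exists_isMaxOn ⟨p, hpA⟩
    (isCompact_slabBarrier_le hproper hM.isClosed hYc hr _)
  simp only [← sub_eq_add_neg] at hmax
  obtain ⟨hqB, hqt, hqc, hqK⟩ := hinside q hqA.1 hqA.2.1
    (sub_pos.1 ((sub_pos.2 hlt).trans_le (hmax hpA)))
  refine not_isLocalMax_sub_slabMajorant hM hY hinj (hM.diff_eq_interior_diff ▸ hqB).1
    (hG q hqB hqt) C c hδ (hr q hqA.1 hqA.2.1) hqt ?_
  have hτ : Continuous fun q => |Y q 1 - t₀| := by fun_prop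
  filter_upwards [hM.isOpen_diff.mem_nhds hqB, hτ.continuousAt.eventually_lt_const hqc,
    ((continuousAt_slabBarrier t₀ (hr0 q hqA.1 hqA.2.1)).comp
      hYc.continuousAt).eventually_lt_const hqK] with q' hq'M hq'c hq'K
  exact hmax ⟨hq'M.1, hq'c.le, hq'K.le⟩

theorem IsGraphLift.nonpos_of_nonpos_on_plane (hφ : IsGraphLift Y M Ω φ)
    (hproper : IsProperMap (M.domRestrict Y)) (hΩ : IsClosed Ω)
    (hM : IsSurfaceWithBoundary M B) (hY : IsConformalMinimalImmersion Y M B) {t₀ C : ℝ}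
    {G : R → ℝ} (husc : UpperSemicontinuousOn G M) (hGC : ∀ q ∈ M, G q ≤ C)
    (hGB : ∀ q ∈ B, G q ≤ 0) (hG₀ : ∀ q ∈ M, Y q 1 = t₀ → G q ≤ 0)
    (hG : ∀ q ∈ M \ B, Y q 1 ≠ t₀ → IsHarmonicAt G q) {p : R} (hp : p ∈ M) : G p ≤ 0 := by
  have hslab (c : ℝ) (hpc : |Y p 1 - t₀| < c) : G p ≤ max C 0 / c * |Y p 1 - t₀| := by
    have hc : 0 < c := (abs_nonneg _).trans_lt hpc
    obtain ⟨h, hr⟩ := hφ.exists_one_le_sq_add_sq hΩ hY.smooth.continuous t₀ c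
    have hle (δ : ℝ) (hδ : δ ∈ Ioi 0) : G p ≤ slabMajorant (max C 0) c δ h t₀ (Y p) :=
      le_slabMajorant hM hY hφ.injOn hproper hc hδ (le_max_right _ _) hr husc
        (fun q hq => (hGC q hq).trans (le_max_left _ _)) hGB hG₀ hG hp hpc.le
    have hlim : Tendsto (fun δ => slabMajorant (max C 0) c δ h t₀ (Y p)) (𝓝[>] 0)
        (𝓝 (max C 0 / c * |Y p 1 - t₀| + 0 * (slabBarrier h t₀ (Y p) + c ^ 2))) :=
      tendsto_const_nhds.add ((tendsto_id.mono_left nhdsWithin_le_nhds).mul_const _)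
    rw [zero_mul, add_zero] at hlim
    exact ge_of_tendsto hlim (eventually_mem_nhdsWithin.mono hle)
  have hlim : Tendsto (fun c => max C 0 / c * |Y p 1 - t₀|) atTop (𝓝 (0 * |Y p 1 - t₀|)) :=
    (tendsto_const_nhds.div_atTop tendsto_id).mul_const _
  rw [zero_mul] at hlim
  exact ge_of_tendsto hlim ((eventually_gt_atTop _).mono hslab)

end MaximumPrinciple

section MonotoneFunctions

theorem strictMonoOn_or_strictAntiOn_of_deriv_ne_zero {J : Set ℝ} (hJ : IsOpen J)
    (hJc : Convex ℝ J) {θ : ℝ → ℝ} (hθ : ∀ y ∈ J, deriv θ y ≠ 0) :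
    StrictMonoOn θ J ∨ StrictAntiOn θ J := by
  have hderiv (y) (hy : y ∈ J) : HasDerivAt θ (deriv θ y) y :=
    (differentiableAt_of_deriv_ne_zero (hθ y hy)).hasDerivAt
  have hcont : ContinuousOn θ J := fun y hy => (hderiv y hy).continuousAt.continuousWithinAt
  rcases hasDerivWithinAt_forall_lt_or_forall_gt_of_forall_ne hJc
    (fun y hy => (hderiv y hy).hasDerivWithinAt) hθ with h | h
  · exact Or.inr (strictAntiOn_of_deriv_neg hJc hcont (by rwa [hJ.interior_eq]))
  · exact Or.inl (strictMonoOn_of_deriv_pos hJc hcont (by rwa [hJ.interior_eq]))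

theorem isOpen_image_of_strictMonoOn_or_strictAntiOn {J : Set ℝ} (hJ : IsOpen J) {θ : ℝ → ℝ}
    (hcont : ContinuousOn θ J) (hmono : StrictMonoOn θ J ∨ StrictAntiOn θ J) :
    IsOpen (θ '' J) := by
  rw [isOpen_iff_mem_nhds]
  rintro _ ⟨y, hy, rfl⟩
  obtain ⟨η, hη, hball⟩ := Metric.nhds_basis_closedBall.mem_iff.1 (hJ.mem_nhds hy)
  rw [Real.closedBall_eq_Icc] at hball
  have hl : y - η ∈ J := hball ⟨le_rfl, by linarith⟩
  have hu : y + η ∈ J := hball ⟨by linarith, le_rfl⟩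
  have huIcc : uIcc (y - η) (y + η) ⊆ J := by rwa [uIcc_of_le (by linarith)]
  refine mem_of_superset ?_ ((intermediate_value_uIcc (hcont.mono huIcc)).trans
    (image_mono huIcc))
  rcases hmono with h | h
  · have hly := h hl hy (by linarith)
    have hyu := h hy hu (by linarith)
    rw [uIcc_of_le (hly.trans hyu).le]
    exact Icc_mem_nhds hly hyu
  · have hly := h hl hy (by linarith)
    have hyu := h hy hu (by linarith)
    rw [uIcc_of_ge (hyu.trans hly).le]
    exact Icc_mem_nhds hyu hly

theorem exists_Icc_of_mem_Icc_image {J : Set ℝ} {θ : ℝ → ℝ}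
    (hmono : StrictMonoOn θ J ∨ StrictAntiOn θ J) {x₀ x₁ : ℝ} (hx₀ : x₀ ∈ θ '' J)
    (hx₁ : x₁ ∈ θ '' J) : ∃ y₀ ∈ J, ∃ y₁ ∈ J, ∀ y ∈ J, θ y ∈ Icc x₀ x₁ → y ∈ Icc y₀ y₁ := by
  obtain ⟨y₀, hy₀, rfl⟩ := hx₀
  obtain ⟨y₁, hy₁, rfl⟩ := hx₁
  rcases hmono with h | h
  · exact ⟨y₀, hy₀, y₁, hy₁, fun y hy hθ =>
      ⟨(h.le_iff_le hy₀ hy).1 hθ.1, (h.le_iff_le hy hy₁).1 hθ.2⟩⟩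
  · exact ⟨y₁, hy₁, y₀, hy₀, fun y hy hθ =>
      ⟨(h.le_iff_ge hy hy₁).1 hθ.2, (h.le_iff_ge hy₀ hy).1 hθ.1⟩⟩

theorem isCompact_inter_preimage_Icc {J : Set ℝ} (hJ : J.OrdConnected) {θ : ℝ → ℝ}
    (hcont : ContinuousOn θ J) (hmono : StrictMonoOn θ J ∨ StrictAntiOn θ J) {x₀ x₁ : ℝ}
    (hx₀ : x₀ ∈ θ '' J) (hx₁ : x₁ ∈ θ '' J) : IsCompact (J ∩ θ ⁻¹' Icc x₀ x₁) := by
  obtain ⟨y₀, hy₀, y₁, hy₁, hIcc⟩ := exists_Icc_of_mem_Icc_image hmono hx₀ hx₁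
  have hsub : Icc y₀ y₁ ⊆ J := hJ.out hy₀ hy₁
  have heq : J ∩ θ ⁻¹' Icc x₀ x₁ = Icc y₀ y₁ ∩ θ ⁻¹' Icc x₀ x₁ :=
    Subset.antisymm (fun y hy => ⟨hIcc y hy.1 hy.2, hy.2⟩) (inter_subset_inter_left _ hsub)
  rw [heq]
  exact isCompact_Icc.of_isClosed_subset
    ((hcont.mono hsub).preimage_isClosed_of_isClosed isClosed_Icc isClosed_Icc) inter_subset_left

end MonotoneFunctions

section StrongMaximum

theorem lowerSemicontinuousOn_of_nonneg {X : Type*} [TopologicalSpace X] {s : Set X} {W : X → ℝ}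
    (hW : ∀ x, 0 ≤ W x) (hcont : ∀ x ∈ s, W x ≠ 0 → ContinuousAt W x) :
    LowerSemicontinuousOn W s := by
  intro x hx
  by_cases hWx : W x = 0
  · refine lowerSemicontinuousWithinAt_iff.2 fun y hy => Eventually.of_forall fun x' => ?_
    exact (hy.trans_eq hWx).trans_le (hW x')
  · exact (hcont x hx hWx).continuousWithinAt.lowerSemicontinuousWithinAt

variable {R : Type*} [TopologicalSpace R] [ChartedSpace ℂ R] {M : Set R} {G H : R → ℝ} {p : R}

theorem IsHarmonicAt.congr (hG : IsHarmonicAt G p) (h : G =ᶠ[𝓝 p] H) : IsHarmonicAt H p :=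
  fun e he hp =>
    (harmonicAt_congr_nhds (h.comp_tendsto (e.tendsto_symm hp))).1 (hG e he hp)

theorem IsHarmonicAt.continuousAt (hG : IsHarmonicAt G p) : ContinuousAt G p := by
  have hp := mem_chart_source ℂ p
  refine ((hG _ (chart_mem_atlas ℂ p) hp).1.continuousAt.comp
    ((chartAt ℂ p).continuousAt hp)).congr ?_
  filter_upwards [(chartAt ℂ p).open_source.mem_nhds hp] with q hq
  exact congrArg G ((chartAt ℂ p).left_inv hq)

theorem IsHarmonicAt.eventually_eq_of_isLocalMax (hG : IsHarmonicAt G p) (hmax : IsLocalMax G p) :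
    ∀ᶠ q in 𝓝 p, G q = G p := by
  have hp := mem_chart_source ℂ p
  have hloc : IsLocalMax (G ∘ (chartAt ℂ p).symm) (chartAt ℂ p p) := by
    filter_upwards [((chartAt ℂ p).tendsto_symm hp).eventually hmax] with ζ hζ
    rwa [Function.comp_apply, Function.comp_apply, (chartAt ℂ p).left_inv hp]
  filter_upwards [((chartAt ℂ p).continuousAt hp).eventually
    (eventually_eq_of_harmonicAt_of_isLocalMax (hG _ (chart_mem_atlas ℂ p) hp) hloc),
    (chartAt ℂ p).open_source.mem_nhds hp] with q hq hqs
  simpa only [Function.comp_apply, (chartAt ℂ p).left_inv hp, (chartAt ℂ p).left_inv hqs] using hq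

theorem nonpos_of_isPreconnected_of_isMaxOn (hM : IsPreconnected M)
    (husc : UpperSemicontinuousOn G M)
    (hharm : ∀ q ∈ M, 0 < G q → q ∈ interior M ∧ IsHarmonicAt G q) (hp : p ∈ M)
    (hmax : IsMaxOn G M p) {p₁ : R} (hp₁ : p₁ ∈ M) (hGp₁ : G p₁ ≤ 0) : G p ≤ 0 := by
  by_contra! hpos
  have hlevel (q) (hq : q ∈ M) (hqp : G q = G p) : ∀ᶠ q' in 𝓝 q, G q' = G p := by
    obtain ⟨hqM, hqG⟩ := hharm q hq (hqp ▸ hpos)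
    rw [← hqp]
    refine hqG.eventually_eq_of_isLocalMax ?_
    filter_upwards [mem_interior_iff_mem_nhds.1 hqM] with q' hq'
    exact (hmax hq').trans_eq hqp.symm
  obtain ⟨u, hu, hMu⟩ := upperSemicontinuousOn_iff_preimage_Iio.1 husc (G p)
  have hcover : M ⊆ interior {q | G q = G p} ∪ u := by
    intro q hq
    rcases (show G q ≤ G p from hmax hq).eq_or_lt with h | h
    · exact Or.inl (mem_interior_iff_mem_nhds.2 (hlevel q hq h))
    · exact Or.inr (hMu.subset ⟨hq, h⟩).2
  obtain ⟨q, hqM, hqint, hqu⟩ := hM (interior {q | G q = G p}) u isOpen_interior hu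
    hcover ⟨p, hp, mem_interior_iff_mem_nhds.2 (hlevel p hp rfl)⟩
    ⟨p₁, hp₁, (hMu.subset ⟨hp₁, hGp₁.trans_lt hpos⟩).2⟩
  exact (hMu.superset ⟨hqM, hqu⟩).2.ne (interior_subset (s := {q | G q = G p}) hqint)

end StrongMaximum

section Axis

variable {R : Type*} [TopologicalSpace R] [ChartedSpace ℂ R]
  {Y : R → E3} {M B : Set R} {Ω : Set ℂ} {φ : ℂ → R} {z₀ : ℂ} {Φ : ℂ → ℂ}

/-- The intersection of the interior of `Ω` with the real direction through `z₀`, as a set of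
real parameters `y` standing for the points `z₀ + y`. -/
def axis (Ω : Set ℂ) (z₀ : ℂ) : Set ℝ := {y | z₀ + (y : ℂ) ∈ interior Ω}

theorem isOpen_axis : IsOpen (axis Ω z₀) :=
  isOpen_interior.preimage (continuous_const.add Complex.continuous_ofReal)

theorem zero_mem_axis (hz₀ : z₀ ∈ interior Ω) : 0 ∈ axis Ω z₀ := by
  rwa [axis, mem_ofPred_eq, Complex.ofReal_zero, add_zero]

theorem convex_axis (hz₀ : z₀ ∈ interior Ω) (hstar : StarConvex ℝ z₀ Ω) :
    Convex ℝ (axis Ω z₀) := by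
  have hstar' : StarConvex ℝ 0 (axis Ω z₀) := by
    have hline : StarConvex ℝ (0 : ℂ) ((fun w => z₀ + w) ⁻¹' interior Ω) :=
      StarConvex.preimage_add_right (by rw [add_zero]; exact starConvex_interior hz₀ hstar)
    exact hline.linear_preimage (f := Complex.ofRealCLM.toLinearMap) (x := (0 : ℝ))
  exact (hstar'.isPathConnected (zero_mem_axis hz₀)).isConnected.isPreconnected.ordConnected.convex

namespace IsConjugateCoordinate

theorem ofReal_re_apply_of_im_eq (hΦ : IsConjugateCoordinate Y M Ω z₀ Φ) {w : ℂ}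
    (hw : w.im = z₀.im) : ((Φ w).re : ℂ) = Φ w :=
  Complex.ext (Complex.ofReal_re _)
    ((Complex.ofReal_im _).trans ((hΦ.im_apply w).trans (sub_eq_zero.2 hw)).symm)

theorem eq_add_ofReal_of_apply_eq_ofReal (hΦ : IsConjugateCoordinate Y M Ω z₀ Φ) {w : ℂ} {x : ℝ}
    (hw : Φ w = x) : w = z₀ + ((w - z₀).re : ℂ) := by
  have him : w.im = z₀.im := by
    rw [← sub_eq_zero, ← hΦ.im_apply, hw, Complex.ofReal_im]
  exact Complex.ext (by simp) (by simp [him])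

theorem ofReal_preimage_image_eq (hΦ : IsConjugateCoordinate Y M Ω z₀ Φ) :
    Complex.ofReal ⁻¹' (Φ '' interior Ω) =
      (fun y : ℝ => (Φ (z₀ + y)).re) '' axis Ω z₀ := by
  ext x
  constructor
  · rintro ⟨w, hw, hwx⟩
    have hwz := hΦ.eq_add_ofReal_of_apply_eq_ofReal hwx
    refine ⟨(w - z₀).re, ?_, ?_⟩
    · rwa [axis, mem_ofPred_eq, ← hwz]
    · beta_reduce
      rw [← hwz, hwx, Complex.ofReal_re]
  · rintro ⟨y, hy, rfl⟩
    exact ⟨_, hy, (hΦ.ofReal_re_apply_of_im_eq (by simp)).symm⟩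

theorem hasDerivAt_re_apply_add (hΦ : IsConjugateCoordinate Y M Ω z₀ Φ) {y : ℝ}
    (hy : y ∈ axis Ω z₀) :
    HasDerivAt (fun y : ℝ => (Φ (z₀ + y)).re) (fderiv ℝ Φ (z₀ + y) 1).re y :=
  Complex.reCLM.hasFDerivAt.comp_hasDerivAt y <|
    (hΦ.differentiableAt _ hy).hasFDerivAt.comp_hasDerivAt y
      ((Complex.ofRealCLM.hasDerivAt (x := y)).const_add z₀)

theorem continuousOn_re_apply_add (hΦ : IsConjugateCoordinate Y M Ω z₀ Φ) :
    ContinuousOn (fun y : ℝ => (Φ (z₀ + y)).re) (axis Ω z₀) :=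
  fun _ hy => (hΦ.hasDerivAt_re_apply_add hy).continuousAt.continuousWithinAt

variable [IsManifold 𝓘(ℂ) ω R]

theorem strictMonoOn_or_strictAntiOn (hΦ : IsConjugateCoordinate Y M Ω z₀ Φ)
    (hφ : IsGraphLift Y M Ω φ) (hM : IsSurfaceWithBoundary M B)
    (hY : IsConformalMinimalImmersion Y M B) (hz₀ : z₀ ∈ interior Ω) (hstar : StarConvex ℝ z₀ Ω) :
    StrictMonoOn (fun y : ℝ => (Φ (z₀ + y)).re) (axis Ω z₀) ∨
      StrictAntiOn (fun y : ℝ => (Φ (z₀ + y)).re) (axis Ω z₀) :=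
  strictMonoOn_or_strictAntiOn_of_deriv_ne_zero isOpen_axis (convex_axis hz₀ hstar) fun y hy => by
    rw [(hΦ.hasDerivAt_re_apply_add hy).deriv]
    exact hΦ.re_fderiv_one_ne_zero hφ hM hY hy

theorem isOpen_ofReal_preimage_image (hΦ : IsConjugateCoordinate Y M Ω z₀ Φ)
    (hφ : IsGraphLift Y M Ω φ) (hM : IsSurfaceWithBoundary M B)
    (hY : IsConformalMinimalImmersion Y M B) (hz₀ : z₀ ∈ interior Ω) (hstar : StarConvex ℝ z₀ Ω) :
    IsOpen (Complex.ofReal ⁻¹' (Φ '' interior Ω)) := by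
  rw [hΦ.ofReal_preimage_image_eq]
  exact isOpen_image_of_strictMonoOn_or_strictAntiOn isOpen_axis hΦ.continuousOn_re_apply_add
    (hΦ.strictMonoOn_or_strictAntiOn hφ hM hY hz₀ hstar)

theorem isCompact_preimage_Icc (hΦ : IsConjugateCoordinate Y M Ω z₀ Φ)
    (hφ : IsGraphLift Y M Ω φ) (hM : IsSurfaceWithBoundary M B)
    (hY : IsConformalMinimalImmersion Y M B) (hz₀ : z₀ ∈ interior Ω) (hstar : StarConvex ℝ z₀ Ω)
    {x₀ x₁ : ℝ} (hx₀ : (x₀ : ℂ) ∈ Φ '' interior Ω) (hx₁ : (x₁ : ℂ) ∈ Φ '' interior Ω) :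
    IsCompact {p ∈ interior M | Φ (proj (Y p)) ∈ Complex.ofReal '' Icc x₀ x₁} := by
  rw [← mem_preimage, hΦ.ofReal_preimage_image_eq] at hx₀ hx₁
  have hline : ContinuousOn (fun y : ℝ => φ (z₀ + y)) (axis Ω z₀) :=
    hφ.continuousOn.comp (continuous_const.add Complex.continuous_ofReal).continuousOn
      fun y hy => interior_subset hy
  convert (isCompact_inter_preimage_Icc (convex_axis hz₀ hstar).ordConnected
    hΦ.continuousOn_re_apply_add (hΦ.strictMonoOn_or_strictAntiOn hφ hM hY hz₀ hstar)
    hx₀ hx₁).image_of_continuousOn (hline.mono inter_subset_left)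
  ext p
  constructor
  · rintro ⟨hp, x, hx, hxp⟩
    have hpz := hΦ.eq_add_ofReal_of_apply_eq_ofReal hxp.symm
    refine ⟨(proj (Y p) - z₀).re, ⟨?_, ?_⟩, ?_⟩
    · rw [axis, mem_ofPred_eq, ← hpz]
      exact hφ.proj_mem_interior hM hY hp
    · rwa [mem_preimage, ← hpz, ← hxp, Complex.ofReal_re]
    · beta_reduce
      rw [← hpz, hφ.apply_proj p (interior_subset hp)]
  · rintro ⟨y, ⟨hy, hyx⟩, rfl⟩
    refine ⟨hφ.mapsTo_interior hY.smooth hy, _, hyx, ?_⟩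
    rw [hφ.proj_apply _ (interior_subset hy)]
    exact hΦ.ofReal_re_apply_of_im_eq (by simp)

end IsConjugateCoordinate

/-- A barrier on the surface relative to the plane `x 1 = t₀`: a nonnegative function, harmonic off
a compact subset `S` of that plane section, that exceeds any constant on the section outside
a compact set. -/
structure IsPlaneBarrier (Y : R → E3) (M : Set R) (t₀ : ℝ) (S : Set R) (W : R → ℝ) : Prop where
  isCompact : IsCompact S
  subset : S ⊆ M
  apply_eq : ∀ p ∈ S, Y p 1 = t₀
  nonneg : ∀ p, 0 ≤ W p
  isHarmonicAt : ∀ p ∈ interior M, p ∉ S → IsHarmonicAt W p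
  lowerSemicontinuousOn : LowerSemicontinuousOn W M
  exists_isCompact : ∀ Λ : ℝ, ∃ K ⊆ M, IsCompact K ∧
    ∀ p ∈ interior M, Y p 1 = t₀ → W p ≤ Λ → p ∈ K

variable [IsManifold 𝓘(ℂ) ω R]

theorem IsConjugateCoordinate.isPlaneBarrier (hΦ : IsConjugateCoordinate Y M Ω z₀ Φ)
    (hφ : IsGraphLift Y M Ω φ) (hM : IsSurfaceWithBoundary M B)
    (hY : IsConformalMinimalImmersion Y M B) (hz₀ : z₀ ∈ interior Ω) (hstar : StarConvex ℝ z₀ Ω)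
    {r : ℝ} {V : ℂ → ℝ} (hV : IsSlitBarrier r (Complex.ofReal ⁻¹' (Φ '' interior Ω)) V)
    (hl : ((-r : ℝ) : ℂ) ∈ Φ '' interior Ω) (hr : (r : ℂ) ∈ Φ '' interior Ω) :
    IsPlaneBarrier Y M z₀.im {p ∈ interior M | Φ (proj (Y p)) ∈ slit r}
      ((interior M).indicator fun p => V (Φ (proj (Y p)))) := by
  have hmem (p) (hp : p ∈ interior M) : Φ (proj (Y p)) ∈ Φ '' interior Ω :=
    mem_image_of_mem _ (hφ.proj_mem_interior hM hY hp)
  have hre (p) (him : (Φ (proj (Y p))).im = 0) : ((Φ (proj (Y p))).re : ℂ) = Φ (proj (Y p)) :=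
    Complex.ext (Complex.ofReal_re _) ((Complex.ofReal_im _).trans him.symm)
  have hW (p) : 0 ≤ (interior M).indicator (fun p => V (Φ (proj (Y p)))) p :=
    indicator_nonneg (fun _ _ => hV.nonneg _) p
  have hharm (p) (hp : p ∈ interior M) (hps : Φ (proj (Y p)) ∉ slit r) :
      IsHarmonicAt ((interior M).indicator fun p => V (Φ (proj (Y p)))) p := by
    refine ((hΦ.isHolomorphicAt p hp).isHarmonicAt_comp (hV.harmonicAt _ hps fun him => ?_)).congr
      (eqOn_indicator.symm.eventuallyEq_of_mem (isOpen_interior.mem_nhds hp))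
    rw [mem_preimage, hre p him]
    exact hmem p hp
  refine ⟨hΦ.isCompact_preimage_Icc hφ hM hY hz₀ hstar hl hr, fun p hp => interior_subset hp.1,
    ?_, hW, fun p hp hps => hharm p hp fun h => hps ⟨hp, h⟩, ?_, ?_⟩
  · rintro p ⟨-, x, -, hx⟩
    have him := hΦ.im_apply (proj (Y p))
    rw [← hx, Complex.ofReal_im, eq_comm, sub_eq_zero] at him
    exact him
  · refine lowerSemicontinuousOn_of_nonneg hW fun p _ hpW => ?_
    have hp : p ∈ interior M := mem_of_indicator_ne_zero hpW
    rw [indicator_of_mem hp] at hpW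
    exact (hharm p hp fun h => hpW (hV.eq_zero _ h)).continuousAt
  · intro Λ
    obtain ⟨x₀, hx₀, x₁, hx₁, hΛ⟩ := hV.exists_Icc Λ
    refine ⟨_, fun p hp => interior_subset hp.1,
      hΦ.isCompact_preimage_Icc hφ hM hY hz₀ hstar hx₀ hx₁, fun p hp hpt hpΛ => ?_⟩
    have hrep := hΦ.ofReal_re_apply_of_im_eq (w := proj (Y p)) hpt
    rw [indicator_of_mem hp, ← hrep] at hpΛ
    exact ⟨hp, _, hΛ _ (by rw [mem_preimage, hrep]; exact hmem p hp) hpΛ, hrep⟩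

theorem IsGraphLift.exists_isPlaneBarrier (hφ : IsGraphLift Y M Ω φ)
    (hM : IsSurfaceWithBoundary M B) (hY : IsConformalMinimalImmersion Y M B)
    (hz₀ : z₀ ∈ interior Ω) (hstar : StarConvex ℝ z₀ Ω) :
    ∃ S W, S.Nonempty ∧ IsPlaneBarrier Y M z₀.im S W := by
  obtain ⟨Φ, hΦ⟩ := hφ.exists_isConjugateCoordinate hM hY hz₀ hstar
  have hopen := hΦ.isOpen_ofReal_preimage_image hφ hM hY hz₀ hstar
  have hzero : (0 : ℝ) ∈ Complex.ofReal ⁻¹' (Φ '' interior Ω) :=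
    ⟨z₀, hz₀, by rw [hΦ.map_base, Complex.ofReal_zero]⟩
  obtain ⟨η, hη, hball⟩ := Metric.nhds_basis_closedBall.mem_iff.1 (hopen.mem_nhds hzero)
  rw [Real.closedBall_eq_Icc, zero_sub, zero_add] at hball
  obtain ⟨V, hV⟩ := exists_isSlitBarrier (half_pos hη) hopen
    ⟨η, hball ⟨by linarith, le_rfl⟩, half_lt_self hη⟩
    ⟨-η, hball ⟨le_rfl, by linarith⟩, neg_lt_neg (half_lt_self hη)⟩
  have hbarrier := hΦ.isPlaneBarrier hφ hM hY hz₀ hstar hV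
    (hball ⟨by linarith, by linarith⟩) (hball ⟨by linarith, by linarith⟩)
  refine ⟨_, _, ⟨φ z₀, ?_⟩, hbarrier⟩
  refine ⟨hφ.mapsTo_interior hY.smooth hz₀, ?_⟩
  rw [hφ.proj_apply _ (interior_subset hz₀), hΦ.map_base, ← Complex.ofReal_zero, ofReal_mem_slit]
  exact ⟨by linarith, by linarith⟩

end Axis

section Parabolicity

theorem IsGraphLift.isPreconnected {R : Type*} [TopologicalSpace R] {Y : R → E3}
    {M : Set R} {Ω : Set ℂ} {φ : ℂ → R} (hφ : IsGraphLift Y M Ω φ) (hΩ : IsPreconnected Ω) :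
    IsPreconnected M := by
  have himage : φ '' Ω = M := Subset.antisymm hφ.mapsTo.image_subset fun p hp =>
    ⟨proj (Y p), hφ.proj_mem p hp, hφ.apply_proj p hp⟩
  exact himage ▸ hΩ.image φ hφ.continuousOn

variable {R : Type*} [TopologicalSpace R] [ChartedSpace ℂ R] [IsManifold 𝓘(ℂ) ω R]
  {Y : R → E3} {M B : Set R} {Ω : Set ℂ} {φ : ℂ → R} {t₀ C : ℝ} {z₀ : ℂ}

theorem IsGraphLift.nonpos_of_isCompact (hφ : IsGraphLift Y M Ω φ)
    (hproper : IsProperMap (M.domRestrict Y)) (hΩ : IsClosed Ω) (hΩc : IsPreconnected Ω)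
    (hM : IsSurfaceWithBoundary M B) (hY : IsConformalMinimalImmersion Y M B) {G : R → ℝ}
    (husc : UpperSemicontinuousOn G M) (hGC : ∀ q ∈ M, G q ≤ C) (hGB : ∀ q ∈ B, G q ≤ 0)
    (hG : ∀ q ∈ M \ B, Y q 1 ≠ t₀ ∨ 0 < G q → IsHarmonicAt G q) {K : Set R} (hK : IsCompact K)
    (hKM : K ⊆ M) (hGK : ∀ q ∈ M, Y q 1 = t₀ → 0 < G q → q ∈ K) {p₁ : R} (hp₁ : p₁ ∈ M)
    (hGp₁ : G p₁ ≤ 0) {p : R} (hp : p ∈ M) : G p ≤ 0 := by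
  by_cases hG₀ : ∀ q ∈ M, Y q 1 = t₀ → G q ≤ 0
  · exact hφ.nonpos_of_nonpos_on_plane hproper hΩ hM hY husc hGC hGB hG₀
      (fun q hq hqt => hG q hq (Or.inl hqt)) hp
  push Not at hG₀
  obtain ⟨q, hq, hqt, hGq⟩ := hG₀
  obtain ⟨k, hkK, hkmax⟩ := (husc.mono hKM).exists_isMaxOn ⟨q, hGK q hq hqt hGq⟩ hK
  have hGk : 0 < G k := hGq.trans_le (hkmax (hGK q hq hqt hGq))
  have hmax : IsMaxOn G M k := fun x hx => by
    refine sub_nonpos.1 (hφ.nonpos_of_nonpos_on_plane hproper hΩ hM hY (t₀ := t₀) (C := C)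
      (G := fun x => G x - G k) ?_ ?_ ?_ ?_ ?_ hx)
    · simpa only [sub_eq_add_neg] using husc.add upperSemicontinuousOn_const
    · exact fun x hx => by linarith [hGC x hx]
    · exact fun x hx => by linarith [hGB x hx]
    · intro x hx hxt
      by_cases hGx : 0 < G x
      · exact sub_nonpos.2 (hkmax (hGK x hx hxt hGx))
      · linarith
    · exact fun x hx hxt => (hG x hx (Or.inl hxt)).sub_const _
  refine absurd (nonpos_of_isPreconnected_of_isMaxOn (hφ.isPreconnected hΩc) husc
    (fun x hx hGx => ?_) (hKM hkK) hmax hp₁ hGp₁) hGk.not_ge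
  have hxB : x ∈ M \ B := ⟨hx, fun hxB => hGx.not_ge (hGB x hxB)⟩
  exact ⟨(hM.diff_eq_interior_diff ▸ hxB).1, hG x hxB (Or.inr hGx)⟩

theorem IsPlaneBarrier.sub_mul_nonpos {S : Set R} {W f : R → ℝ}
    (hW : IsPlaneBarrier Y M t₀ S W) (hS : S.Nonempty) (hφ : IsGraphLift Y M Ω φ)
    (hproper : IsProperMap (M.domRestrict Y)) (hΩ : IsClosed Ω) (hΩc : IsPreconnected Ω)
    (hM : IsSurfaceWithBoundary M B) (hY : IsConformalMinimalImmersion Y M B)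
    (hf : ContinuousOn f M) (hC : ∀ p ∈ M, f p ≤ C) (hharm : ∀ p ∈ M \ B, IsHarmonicAt f p)
    (hfB : ∀ p ∈ B, f p ≤ 0) (hfS : ∀ p ∈ S, f p ≤ 0) {ε : ℝ} (hε : 0 < ε) {p : R} (hp : p ∈ M) :
    f p - ε * W p ≤ 0 := by
  have hle (q) : f q - ε * W q ≤ f q := sub_le_self _ (mul_nonneg hε.le (hW.nonneg q))
  have hpos (q) (hq : q ∈ M) (hGq : 0 < f q - ε * W q) : q ∈ interior M ∧ q ∉ S := by
    have hfq : 0 < f q := hGq.trans_le (hle q)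
    have hqB : q ∈ M \ B := ⟨hq, fun hqB => hfq.not_ge (hfB q hqB)⟩
    exact ⟨(hM.diff_eq_interior_diff ▸ hqB).1, fun hqS => hfq.not_ge (hfS q hqS)⟩
  obtain ⟨K, hKM, hK, hWK⟩ := hW.exists_isCompact (C / ε)
  obtain ⟨p₁, hp₁⟩ := hS
  refine hφ.nonpos_of_isCompact hproper hΩ hΩc hM hY (t₀ := t₀) (C := C)
    (G := fun q => f q - ε * W q) ?_ (fun q hq => (hle q).trans (hC q hq))
    (fun q hq => (hle q).trans (hfB q hq)) (fun q hq hqG => ?_) hK hKM (fun q hq hqt hGq => ?_)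
    (hW.subset hp₁) ((hle p₁).trans (hfS p₁ hp₁)) hp
  · have hWusc : UpperSemicontinuousOn (fun q => -(ε * W q)) M :=
      (continuous_const.mul continuous_id).neg.comp_lowerSemicontinuousOn_antitone
        hW.lowerSemicontinuousOn fun _ _ h => neg_le_neg (mul_le_mul_of_nonneg_left h hε.le)
    simpa only [sub_eq_add_neg] using hf.upperSemicontinuousOn.add hWusc
  · have hqS : q ∉ S := hqG.elim (fun hqt hqS => hqt (hW.apply_eq q hqS))
      fun hGq => (hpos q hq.1 hGq).2
    exact (hharm q hq).sub
      ((hW.isHarmonicAt q (hM.diff_eq_interior_diff ▸ hq).1 hqS).const_mul ε)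
  · refine hWK q (hpos q hq hGq).1 hqt ((le_div_iff₀' hε).2 ?_)
    linarith [hC q hq]

theorem IsPlaneBarrier.exists_forall_le_max {S : Set R} {W f : R → ℝ}
    (hW : IsPlaneBarrier Y M t₀ S W) (hS : S.Nonempty) (hφ : IsGraphLift Y M Ω φ)
    (hproper : IsProperMap (M.domRestrict Y)) (hΩ : IsClosed Ω) (hΩc : IsPreconnected Ω)
    (hM : IsSurfaceWithBoundary M B) (hY : IsConformalMinimalImmersion Y M B)
    (hf : ContinuousOn f M) (hC : ∀ p ∈ M, f p ≤ C) (hharm : ∀ p ∈ M \ B, IsHarmonicAt f p)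
    (hfB : ∀ p ∈ B, f p ≤ 0) : ∃ q ∈ M, ∀ p ∈ M, f p ≤ max (f q) 0 := by
  obtain ⟨q, hqS, hqmax⟩ := hW.isCompact.exists_isMaxOn hS (hf.mono hW.subset)
  refine ⟨q, hW.subset hqS, fun p hp => ?_⟩
  have hle (ε : ℝ) (hε : ε ∈ Ioi 0) : f p ≤ max (f q) 0 + ε * W p := by
    have h := hW.sub_mul_nonpos hS hφ hproper hΩ hΩc hM hY (f := fun x => f x - max (f q) 0)
      (C := C) (hf.sub continuousOn_const)
      (fun x hx => (sub_le_self _ (le_max_right _ _)).trans (hC x hx))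
      (fun x hx => (hharm x hx).sub_const _)
      (fun x hx => sub_nonpos.2 ((hfB x hx).trans (le_max_right _ _)))
      (fun x hx => sub_nonpos.2 ((hqmax hx).trans (le_max_left _ _))) hε hp
    linarith
  have hlim : Tendsto (fun ε => max (f q) 0 + ε * W p) (𝓝[>] 0) (𝓝 (max (f q) 0 + 0 * W p)) :=
    tendsto_const_nhds.add ((tendsto_id.mono_left nhdsWithin_le_nhds).mul_const _)
  rw [zero_mul, add_zero] at hlim
  exact ge_of_tendsto hlim (eventually_mem_nhdsWithin.mono hle)

theorem IsGraphLift.nonpos_of_isHarmonicAt (hφ : IsGraphLift Y M Ω φ)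
    (hproper : IsProperMap (M.domRestrict Y)) (hΩ : IsClosed Ω)
    (hM : IsSurfaceWithBoundary M B) (hB : B.Nonempty) (hY : IsConformalMinimalImmersion Y M B)
    (hz₀ : z₀ ∈ interior Ω) (hstar : StarConvex ℝ z₀ Ω) {f : R → ℝ} (hf : ContinuousOn f M)
    (hC : ∀ p ∈ M, f p ≤ C) (hharm : ∀ p ∈ M \ B, IsHarmonicAt f p) (hfB : ∀ p ∈ B, f p ≤ 0)
    {p : R} (hp : p ∈ M) : f p ≤ 0 := by
  have hΩc : IsPreconnected Ω :=
    (hstar.isPathConnected (interior_subset hz₀)).isConnected.isPreconnected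
  obtain ⟨S, W, hS, hW⟩ := hφ.exists_isPlaneBarrier hM hY hz₀ hstar
  obtain ⟨q, hq, hmax⟩ := hW.exists_forall_le_max hS hφ hproper hΩ hΩc hM hY hf hC hharm hfB
  obtain ⟨b, hb⟩ := hB
  suffices hq₀ : f q ≤ 0 from (hmax p hp).trans_eq (max_eq_right hq₀)
  by_contra! hpos
  refine hpos.not_ge (nonpos_of_isPreconnected_of_isMaxOn (hφ.isPreconnected hΩc)
    hf.upperSemicontinuousOn (fun x hx hfx => ?_) hq
    (fun x hx => (hmax x hx).trans_eq (max_eq_left hpos.le)) (hM.boundary_subset hb) (hfB b hb))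
  have hxB : x ∈ M \ B := ⟨hx, fun hxB => hfx.not_ge (hfB x hxB)⟩
  exact ⟨(hM.diff_eq_interior_diff ▸ hxB).1, hharm x hxB⟩

end Parabolicity

end MinimalGraph

end

theorem mainTheorem4_general {R : Type*} [TopologicalSpace R] [ChartedSpace ℂ R]
    [IsManifold 𝓘(ℂ) ω R] {M B : Set R} (hM : MinimalGraph.IsSurfaceWithBoundary M B)
    (hB : B.Nonempty) {Y : R → MinimalGraph.E3}
    (hY : MinimalGraph.IsConformalMinimalImmersion Y M B)
    (hproper : IsProperMap (M.domRestrict Y))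
    {Ω : Set ℂ} (hΩ : IsClosed Ω) (hgraph : MinimalGraph.IsGraphOver Y M Ω)
    {p₀ : R} (hp₀ : p₀ ∈ interior M) (hstar : StarConvex ℝ (MinimalGraph.proj (Y p₀)) Ω)
    {f : R → ℝ} (hf : ContinuousOn f M) {C : ℝ} (hC : ∀ p ∈ M, f p ≤ C)
    (hharm : ∀ p ∈ M \ B, MinimalGraph.IsHarmonicAt f p) (hfB : ∀ p ∈ B, f p ≤ 0)
    {p : R} (hp : p ∈ M) : f p ≤ 0 := by
  have : Nonempty R := ⟨p₀⟩
  obtain ⟨φ, hφ⟩ := MinimalGraph.exists_isGraphLift hproper hgraph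
  exact hφ.nonpos_of_isHarmonicAt hproper hΩ hM hB hY (hφ.proj_mem_interior hM hY hp₀) hstar hf
    hC hharm hfB hp

theorem mainTheorem4 {R : Type*} [TopologicalSpace R] [T2Space R] [ChartedSpace ℂ R]
    [IsManifold 𝓘(ℂ) ω R] (M B : Set R) (hM : MinimalGraph.IsSurfaceWithBoundary M B)
    (hB : B.Nonempty) (Y : R → MinimalGraph.E3)
    (hY : MinimalGraph.IsConformalMinimalImmersion Y M B)
    (hproper : IsProperMap (M.domRestrict Y))
    (Ω : Set ℂ) (hΩ : IsClosed Ω) (hgraph : MinimalGraph.IsGraphOver Y M Ω)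
    (p₀ : R) (hp₀ : p₀ ∈ M \ B) (hstar : StarConvex ℝ (MinimalGraph.proj (Y p₀)) Ω) :
    MinimalGraph.IsRelativeParabolic M B := by
  intro f hf ⟨C, hC⟩ hharm hfB p hp
  have hp₀M : p₀ ∈ interior M := (hM.diff_eq_interior_diff ▸ hp₀).1
  refine le_antisymm (mainTheorem4_general hM hB hY hproper hΩ hgraph hp₀M hstar hf
    (fun q hq => le_of_abs_le (hC q hq)) hharm (fun q hq => (hfB q hq).le) hp)
    (neg_nonpos.1 (mainTheorem4_general hM hB hY hproper hΩ hgraph hp₀M hstar hf.neg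
      (fun q hq => neg_le.1 (neg_le_of_abs_le (hC q hq)))
      (fun q hq e he hqe => (hharm q hq e he hqe).neg)
      (fun q hq => neg_nonpos.2 (hfB q hq).ge) hp))
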